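/- For $n\ge 1$ let $V_n$ be the simply connected nilpotent Lie group whose Lie algebra $\mathcal V_n$ has the basis $e_1,\dots,e_n$ with brackets $[e_i,e_j]=(j-i)e_{i+j}$ for $i+j\le n$ and $[e_i,e_j]=0$ for $i+j>n$; concretely, $V_n$ is the group of formal changes of variable $x\mapsto x+a_1x^2+\dots+a_nx^{n+1}$ modulo $x^{n+2}$, with $e_k=x^{k+1}\frac{d}{dx}$. Let $\Gamma_n\subset V_n$ be the subgroup generated by $\exp e_1,\dots,\exp e_n$, let $M(n)$ be the quotient of $V_n$ by left translations with elements of $\Gamma_n$, and let $\omega_1,\dots,\omega_n$ be the left-invariant $1$-forms on $V_n$ dual to $e_1,\dots,e_n$. Let $m\ge 2$ and $$\Omega_{2m}=\sum_{i=1}^{m}(2m+1-2i)\,\omega_i\wedge\omega_{2m+1-i}.$$ Then $\Gamma_{2m}$ is discrete, $M(2m)$ is a compact Hausdorff smooth manifold for which the projection $V_{2m}\to M(2m)$ is a local diffeomorphism, $\Omega_{2m}$ descends to a symplectic form $\overline\Omega_{2m}$ on $M(2m)$, and $M(2m)$ admits an integral symplectic form (a symplectic form whose integrals over all integral singular $2$-cycles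 are integers); namely, $N\,\overline\Omega_{2m}$ is such a form for some positive integer $N$ (depending on $m$). -/

import Mathlib

open scoped Manifold ContDiff Topology

noncomputable section

/-! ## Differential 2-forms on manifolds modelled on a normed space -/

section Forms

variable {E : Type*} [NormedAddCommGroup E] [NormedSpace ℝ E]
  {M : Type*} [TopologicalSpace M] [ChartedSpace E M]

variable (E M) in
/-- A (not necessarily smooth) differential 2-form on the manifold `M` modelled on `E`. -/
abbrev TwoForm : Type _ :=
  ∀ p : M, TangentSpace 𝓘(ℝ, E) p [⋀^Fin 2]→L[ℝ] ℝ

/-- The pullback of a 2-form along a map from a normed space to a manifold. -/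
def pullbackForm {F : Type*} [NormedAddCommGroup F] [NormedSpace ℝ F]
    (f : F → M) (η : TwoForm E M) : F → F [⋀^Fin 2]→L[ℝ] ℝ := fun y =>
  (η (f y)).compContinuousLinearMap
    ((mfderiv 𝓘(ℝ, F) 𝓘(ℝ, E) f y).comp
      (NormedSpace.fromTangentSpace (𝕜 := ℝ) y).symm.toContinuousLinearMap)

/-- A symplectic form: a 2-form which is smooth and closed in all charts, and is
nondegenerate at every point. -/
structure IsSymplecticForm (η : TwoForm E M) : Prop where
  smooth : ∀ e ∈ atlas E M, ContDiffOn ℝ ∞ (pullbackForm e.symm η) e.target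
  closed : ∀ e ∈ atlas E M, ∀ y ∈ e.target, extDeriv (pullbackForm e.symm η) y = 0
  nondegenerate : ∀ (p : M) (v : TangentSpace 𝓘(ℝ, E) p), (∀ w, η p ![v, w] = 0) → v = 0

/-- The standard 2-simplex, as the triangle with vertices `(0,0)`, `(1,0)`, `(0,1)`. -/
def stdTriangle : Set (ℝ × ℝ) := {p | 0 ≤ p.1 ∧ 0 ≤ p.2 ∧ p.1 + p.2 ≤ 1}

variable (E M) in
/-- Smooth singular 2-simplices. Only the values on the triangle matter. -/
structure SmoothTriangle where
  toFun : ℝ × ℝ → M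
  smooth : ContMDiffOn 𝓘(ℝ, ℝ × ℝ) 𝓘(ℝ, E) ∞ toFun stdTriangle

/-- The boundary of a singular 2-simplex, as an integral combination of paths in `M`:
the edge from `(1,0)` to `(0,1)`, minus the edge from `(0,0)` to `(0,1)`, plus the edge
from `(0,0)` to `(1,0)`. -/
def SmoothTriangle.boundary (σ : SmoothTriangle E M) : (unitInterval → M) →₀ ℤ :=
  Finsupp.single (fun t : unitInterval => σ.toFun (1 - (t : ℝ), (t : ℝ))) (1 : ℤ)
    - Finsupp.single (fun t : unitInterval => σ.toFun (0, (t : ℝ))) (1 : ℤ)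
    + Finsupp.single (fun t : unitInterval => σ.toFun ((t : ℝ), 0)) (1 : ℤ)

/-- The integral of a 2-form over a smooth singular 2-simplex. -/
def SmoothTriangle.integral (σ : SmoothTriangle E M) (η : TwoForm E M) : ℝ :=
  ∫ p in stdTriangle,
    η (σ.toFun p)
      ![mfderivWithin 𝓘(ℝ, ℝ × ℝ) 𝓘(ℝ, E) σ.toFun stdTriangle p
          ((NormedSpace.fromTangentSpace (𝕜 := ℝ) p).symm (1, 0)),
        mfderivWithin 𝓘(ℝ, ℝ × ℝ) 𝓘(ℝ, E) σ.toFun stdTriangle p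
          ((NormedSpace.fromTangentSpace (𝕜 := ℝ) p).symm (0, 1))]

/-- A smooth singular 2-chain with integer coefficients is a cycle if its boundary vanishes. -/
def IsTwoCycle (c : SmoothTriangle E M →₀ ℤ) : Prop :=
  (c.sum fun σ a => a • σ.boundary) = 0

/-- A 2-form is integral if its integrals over all integral singular 2-cycles are integers. For a
closed form this says that its de Rham class lies in the image of `H²(M; ℤ)` in `H²(M; ℝ)`. -/
def IsIntegralForm (η : TwoForm E M) : Prop :=
  ∀ c : SmoothTriangle E M →₀ ℤ, IsTwoCycle c →
    ∃ k : ℤ, (c.sum fun σ a => (a : ℝ) * σ.integral η) = k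

/-- The wedge product `α ∧ β` of two covectors: `(v, w) ↦ α v * β w - α w * β v`. -/
def wedgeOne (α β : E →L[ℝ] ℝ) : E [⋀^Fin 2]→L[ℝ] ℝ :=
  ContinuousMultilinearMap.alternatization
    ((ContinuousMultilinearMap.mkPiAlgebra ℝ (Fin 2) ℝ).compContinuousLinearMap ![α, β])

theorem wedgeOne_apply (α β : E →L[ℝ] ℝ) (v w : E) :
    wedgeOne α β ![v, w] = α v * β w - α w * β v := by
  have h : (Finset.univ : Finset (Equiv.Perm (Fin 2))) = {1, Equiv.swap 0 1} := by decide
  simp only [wedgeOne, ContinuousMultilinearMap.alternatization_apply_apply, h]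
  rw [Finset.sum_pair (by decide)]
  simp [Fin.prod_univ_two]
  ring

end Forms

/-! ## The nilpotent Lie group `V n` of jets -/

section Group

open Polynomial

/-- The nilpotent group with Lie algebra `L₁ / L_{n+1}`, where `L_k` is the Lie algebra of formal
vector fields on the line spanned by `x ^ (j + 1) d/dx`, `j ≥ k`: its elements are the formal
changes of variable `x ↦ x + a₁ x² + ⋯ + aₙ x ^ (n + 1)` modulo `x ^ (n + 2)`, and
`a₁, …, aₙ` are global coordinates. The coordinate with index `k : Fin n` is `a_{k+1}`. -/
def V (n : ℕ) : Type := Fin n → ℝ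

namespace V

variable {n : ℕ}

instance : NormedAddCommGroup (V n) := inferInstanceAs (NormedAddCommGroup (Fin n → ℝ))
instance : NormedSpace ℝ (V n) := inferInstanceAs (NormedSpace ℝ (Fin n → ℝ))
instance : FiniteDimensional ℝ (V n) := inferInstanceAs (FiniteDimensional ℝ (Fin n → ℝ))

/-- The coordinates `(a₁, …, aₙ)` of an element of `V n`. -/
def coord (n : ℕ) : V n ≃L[ℝ] (Fin n → ℝ) := ContinuousLinearEquiv.refl ℝ (Fin n → ℝ)

/-- The polynomial `x + a₁ x² + ⋯ + aₙ x ^ (n + 1)`. -/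
def toPoly (a : V n) : ℝ[X] := X + ∑ k : Fin n, C (coord n a k) * X ^ ((k : ℕ) + 2)

/-- The coefficients of `x², …, x ^ (n + 1)`. -/
def ofPoly (n : ℕ) (p : ℝ[X]) : V n :=
  (coord n).symm fun k => p.coeff ((k : ℕ) + 2)

theorem coord_ofPoly (p : ℝ[X]) (k : Fin n) :
    coord n (ofPoly n p) k = p.coeff ((k : ℕ) + 2) := rfl

@[ext]
theorem ext {a b : V n} (h : ∀ k, coord n a k = coord n b k) : a = b :=
  (coord n).injective (funext h)

/-- The product of `f` and `g` is the substitution `g(f(x))`; in other words, it corresponds to the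
composition of the substitution operators `p(x) ↦ p(f(x))` and `p(x) ↦ p(g(x))`. -/
instance : Mul (V n) := ⟨fun a b => ofPoly n ((toPoly b).comp (toPoly a))⟩

instance : One (V n) := ⟨(coord n).symm 0⟩

theorem mul_def (a b : V n) : a * b = ofPoly n ((toPoly b).comp (toPoly a)) := rfl

theorem toPoly_one : toPoly (1 : V n) = X := by
  have h : ∀ k : Fin n, coord n (1 : V n) k = 0 := fun _ => rfl
  simp [toPoly, h]

theorem coeff_toPoly (a : V n) (m : ℕ) : (toPoly a).coeff m =
    (if m = 1 then 1 else 0) + ∑ k : Fin n, if m = (k : ℕ) + 2 then coord n a k else 0 := by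
  simp [toPoly, coeff_X, coeff_C_mul, coeff_X_pow, eq_comm (a := m)]

theorem ofPoly_toPoly (a : V n) : ofPoly n (toPoly a) = a := by
  ext k
  rw [coord_ofPoly, coeff_toPoly]
  simp [Fin.val_inj]

theorem X_dvd_toPoly (a : V n) : X ∣ toPoly a := by
  rw [X_dvd_iff, coeff_toPoly]; simp

theorem dvd_sub_toPoly {p : ℝ[X]} (h0 : p.coeff 0 = 0) (h1 : p.coeff 1 = 1) :
    X ^ (n + 2) ∣ p - toPoly (ofPoly n p) := by
  rw [X_pow_dvd_iff]
  intro d hd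
  rw [coeff_sub, coeff_toPoly]
  match d, hd with
  | 0, _ => simp [h0]
  | 1, _ => simp [h1]
  | d + 2, hd =>
    rw [Finset.sum_eq_single (⟨d, by omega⟩ : Fin n)]
    · simp [coord_ofPoly]
    · intro b _ hb
      rw [if_neg]
      intro h
      exact hb (Fin.ext (by simp; omega))
    · simp

theorem ofPoly_congr {p q : ℝ[X]} (h : X ^ (n + 2) ∣ p - q) : ofPoly n p = ofPoly n q := by
  ext k
  rw [X_pow_dvd_iff] at h
  have := h ((k : ℕ) + 2) (by omega)
  rw [coeff_sub] at this
  exact sub_eq_zero.mp this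

theorem comp_congr_left {N : ℕ} {p q r : ℝ[X]} (h : X ^ N ∣ p - q) (hr : X ∣ r) :
    X ^ N ∣ p.comp r - q.comp r := by
  obtain ⟨s, hs⟩ := h
  rw [← sub_comp, hs, mul_comp, X_pow_comp]
  exact (pow_dvd_pow_of_dvd hr N).mul_right _

theorem comp_congr_right (p r s : ℝ[X]) : r - s ∣ p.comp r - p.comp s := by
  have := sub_dvd_eval_sub r s (p.map C)
  simpa [comp, eval_map] using this

theorem coeff_zero_comp (a b : V n) : ((toPoly b).comp (toPoly a)).coeff 0 = 0 := by
  have h := X_dvd_toPoly a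
  rw [X_dvd_iff, coeff_zero_eq_eval_zero] at h
  have h' := X_dvd_toPoly b
  rw [X_dvd_iff, coeff_zero_eq_eval_zero] at h'
  rw [coeff_zero_eq_eval_zero, eval_comp, h, h']

theorem coeff_toPoly_one (a : V n) : (toPoly a).coeff 1 = 1 := by
  rw [coeff_toPoly]; simp

theorem coeff_one_comp (a b : V n) : ((toPoly b).comp (toPoly a)).coeff 1 = 1 := by
  have h : X ^ 2 ∣ (toPoly b).comp (toPoly a) - toPoly a := by
    have : (toPoly b).comp (toPoly a) - toPoly a =
        ∑ k : Fin n, C (coord n b k) * toPoly a ^ ((k : ℕ) + 2) := by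
      simp [toPoly, add_comp, sum_comp]
    rw [this]
    refine Finset.dvd_sum fun k _ => Dvd.dvd.mul_left ?_ _
    exact (pow_dvd_pow X (by omega)).trans (pow_dvd_pow_of_dvd (X_dvd_toPoly a) _)
  rw [X_pow_dvd_iff] at h
  have h1 := h 1 (by norm_num)
  rw [coeff_sub, coeff_toPoly_one] at h1
  linarith

theorem mul_assoc' (a b c : V n) : a * b * c = a * (b * c) := by
  have h1 : X ^ (n + 2) ∣ ((toPoly c).comp (toPoly b)).comp (toPoly a)
      - (toPoly (b * c)).comp (toPoly a) :=
    comp_congr_left (dvd_sub_toPoly (coeff_zero_comp b c) (coeff_one_comp b c)) (X_dvd_toPoly a)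
  have h2 : X ^ (n + 2) ∣ (toPoly c).comp ((toPoly b).comp (toPoly a))
      - (toPoly c).comp (toPoly (a * b)) :=
    (dvd_sub_toPoly (coeff_zero_comp a b) (coeff_one_comp a b)).trans (comp_congr_right _ _ _)
  rw [mul_def (a * b) c, mul_def a (b * c), ← ofPoly_congr h1, ← ofPoly_congr h2, comp_assoc]

theorem mul_one' (a : V n) : a * 1 = a := by
  rw [mul_def, toPoly_one, X_comp, ofPoly_toPoly]

/-- The linear part of a left translation in the coordinates. -/
def leftLinear (a : V n) : (Fin n → ℝ) →ₗ[ℝ] (Fin n → ℝ) where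
  toFun b := fun j => (∑ k : Fin n, C (b k) * toPoly a ^ ((k : ℕ) + 2)).coeff ((j : ℕ) + 2)
  map_add' b c := by
    funext j
    simp [add_mul, Finset.sum_add_distrib]
  map_smul' r b := by
    funext j
    simp [mul_assoc, Finset.mul_sum, coeff_C_mul]

theorem mul_eq_add (a b : V n) : coord n (a * b) = coord n a + leftLinear a (coord n b) := by
  funext j
  rw [mul_def, coord_ofPoly]
  have : (toPoly b).comp (toPoly a) =
      toPoly a + ∑ k : Fin n, C (coord n b k) * toPoly a ^ ((k : ℕ) + 2) := by
    conv_lhs => rw [toPoly]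
    simp [add_comp, sum_comp]
  rw [this, coeff_add]
  exact congrArg₂ (· + ·) (congrFun (congrArg (coord n) (ofPoly_toPoly a)) j) rfl

theorem leftLinear_injective (a : V n) : Function.Injective (leftLinear a) := by
  rw [← LinearMap.ker_eq_bot, LinearMap.ker_eq_bot']
  intro b hb
  have key : ∀ m : ℕ, ∀ k : Fin n, (k : ℕ) = m → b k = 0 := by
    intro m
    induction m using Nat.strong_induction_on with
    | _ m ih =>
      intro k hk
      obtain ⟨q, hq⟩ := X_dvd_toPoly a
      have hq0 : q.coeff 0 = 1 := by
        have := coeff_toPoly_one a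
        rwa [hq, ← zero_add 1, coeff_X_mul] at this
      have h := congrFun hb k
      change (∑ i : Fin n, C (b i) * toPoly a ^ ((i : ℕ) + 2)).coeff ((k : ℕ) + 2) = 0 at h
      rw [finsetSum_coeff, Finset.sum_eq_single k] at h
      · rw [hq, mul_pow, coeff_C_mul, coeff_X_pow_mul', if_pos le_rfl, Nat.sub_self,
          coeff_zero_eq_eval_zero, eval_pow, ← coeff_zero_eq_eval_zero, hq0] at h
        simpa using h
      · intro i _ hik
        rcases lt_or_gt_of_ne (fun h => hik (Fin.ext h) : (i : ℕ) ≠ k) with hlt | hgt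
        · rw [ih i (by omega) i rfl]; simp
        · rw [hq, mul_pow, coeff_C_mul, coeff_X_pow_mul', if_neg (by omega), mul_zero]
      · simp
  funext k
  exact key k k rfl

theorem exists_mul_eq_one (a : V n) : ∃ b : V n, a * b = 1 := by
  obtain ⟨b, hb⟩ := (LinearMap.injective_iff_surjective.mp (leftLinear_injective a))
    (- coord n a)
  refine ⟨(coord n).symm b, (coord n).injective ?_⟩
  rw [mul_eq_add, ContinuousLinearEquiv.apply_symm_apply, hb, add_neg_cancel]
  rfl

instance : Inv (V n) := ⟨fun a => Classical.choose (exists_mul_eq_one a)⟩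

instance : Group (V n) :=
  Group.ofRightAxioms mul_assoc' mul_one' fun a => Classical.choose_spec (exists_mul_eq_one a)

/-- The derivation of `ℝ[x]` given by the vector field `(∑ k, v_k x ^ (k + 1)) d/dx`, where
`v_1, …, v_n` are the coordinates of `v` in the basis `e_k = x ^ (k + 1) d/dx` of the Lie algebra
`L₁ / L_{n+1}`. -/
def vectorField (v : Fin n → ℝ) (p : ℝ[X]) : ℝ[X] :=
  (∑ k : Fin n, C (v k) * X ^ ((k : ℕ) + 2)) * derivative p

/-- The Lie brackets `[e_i, e_j] = (j - i) e_{i+j}`. -/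
theorem vectorField_bracket (i j : Fin n) (p : ℝ[X]) :
    vectorField (Pi.single i 1) (vectorField (Pi.single j 1) p)
      - vectorField (Pi.single j 1) (vectorField (Pi.single i 1) p)
      = C ((j : ℝ) - (i : ℝ)) * (X ^ ((i : ℕ) + (j : ℕ) + 3) * derivative p) := by
  have h : ∀ k : Fin n, (∑ l : Fin n, C ((Pi.single k (1 : ℝ) : Fin n → ℝ) l) * X ^ ((l : ℕ) + 2))
      = (X : ℝ[X]) ^ ((k : ℕ) + 2) := by
    intro k
    rw [Finset.sum_eq_single k]
    · simp
    · intro b _ hb; simp [hb]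
    · simp
  simp only [vectorField, h, derivative_mul, derivative_X_pow]
  simp
  ring

/-- The exponential map of `V n`: the time one flow `x ↦ ∑ i, Dⁱ x / i!` of the vector field `D`
with coordinates `v`. As `Dⁱ x` is divisible by `x ^ (i + 1)`, the terms with `i > n` vanish modulo
`x ^ (n + 2)`. -/
def expMap (v : Fin n → ℝ) : V n :=
  ofPoly n (∑ i ∈ Finset.range (n + 1), C ((i.factorial : ℝ)⁻¹) * (vectorField v)^[i] X)

end V

/-- The subgroup generated by the elements `exp e_1, …, exp e_n` that form the basis
`e_1, …, e_n` of the Lie algebra when `V n` is identified with its Lie algebra through the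
exponential map and the Campbell–Hausdorff formula. -/
def latticeΓ (n : ℕ) : Subgroup (V n) :=
  Subgroup.closure (Set.range fun k : Fin n => V.expMap (Pi.single k 1))

/-- The quotient `Γ \ V n` by left translations with elements of `Γ`, with the quotient topology. -/
def Nilmanifold (n : ℕ) : Type := Quotient (QuotientGroup.rightRel (latticeΓ n))

instance (n : ℕ) : TopologicalSpace (Nilmanifold n) :=
  inferInstanceAs (TopologicalSpace (Quotient (QuotientGroup.rightRel (latticeΓ n))))

/-- The projection of `V n` to the quotient. -/
def Nilmanifold.proj (n : ℕ) (g : V n) : Nilmanifold n :=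
  Quotient.mk (QuotientGroup.rightRel (latticeΓ n)) g

/-- The left-invariant 1-form on `V n` which at the identity is the covector dual to the basis
`e_1, …, e_n`: the vector `u` at `g` is moved to the identity by the differential of the left
translation by `g⁻¹`, and its coordinate is taken there. The index `k : Fin n` stands for the form
with number `k + 1`. -/
def leftForm {n : ℕ} (k : Fin n) (g : V n) : V n →L[ℝ] ℝ :=
  (ContinuousLinearMap.proj (R := ℝ) (φ := fun _ : Fin n => ℝ) k).comp
    ((V.coord n).toContinuousLinearMap.comp (fderiv ℝ (fun h : V n => g⁻¹ * h) g))

/-- The left-invariant 2-form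
`(2m-1) ω_1 ∧ ω_{2m} + (2m-3) ω_2 ∧ ω_{2m-1} + ⋯ + ω_m ∧ ω_{m+1}` on `V (2m)`. -/
def formΩ (m : ℕ) (g : V (2 * m)) : V (2 * m) [⋀^Fin 2]→L[ℝ] ℝ :=
  ∑ i : Fin m, (2 * (m : ℝ) - 1 - 2 * (i : ℝ)) •
    wedgeOne (leftForm (Fin.castLE (by omega) i) g) (leftForm (Fin.castLE (by omega) i).rev g)

end Group

end

/-!
# An integral symplectic form on the nilmanifold of `V (2m)`

In the coordinates `a₁, …, aₙ` every left translation of `V n` is affine, `a * b = a + leftMap a b`,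
so the left-invariant forms are the components of `maurerCartan g = leftMap g⁻¹`. Differentiating
`leftMap (g * b) = leftMap g ∘ leftMap b` gives the Maurer–Cartan equation `fderiv_maurerCartan`.
Read off in the last coordinate of `V (2m + 1)`, it says that `formΩ m` is, up to the sign, the
differential of `ω_{2m+1}`: it is the curvature of the central extension `V (2m + 1) → V (2m)`.
Hence `formΩ m = dθ` on `V (2m)`, where `θ = connectionForm` is minus the restriction of `ω_{2m+1}`
to a section of the extension (`formΩ_eq_fderiv`). This makes the form closed; it is nondegenerate
because it pairs `ω_i` with `ω_{2m+1-i}` with an odd coefficient.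

The lattice is discrete because its coordinates have bounded denominators: after the dilation
`x ↦ n! x` the generators have integer coordinates, and the integer points form a subgroup
(`exists_int_of_mem_latticeΓ`). It is cocompact because left multiplication by powers of
`exp e₁, …, exp eₙ`, in this order, moves the coordinates to `[0, 1]` one after the other
(`exists_mul_mem_box`). So the projection is a covering with compact Hausdorff base, and its local
inverses form an atlas whose transition maps are locally left translations.

The integrality is an instance of the fact that the curvature of a circle bundle is integral. Here
the bundle is the quotient of `V (2m + 1)` by its lattice, over the quotient of `V (2m)`; its
structure group maps onto `AddCircle (1 / N)`, where `N` is a common denominator of the last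
coordinates of the lattice elements, and this quotient suffices. The holonomy of a path `τ` with a
lift `c` to `V (2m)` is defined as `∫_c θ` corrected at the end points by `fibreCoord`, a
set-theoretic section of the bundle. It does not depend on the lift, since a lattice element changes
`θ` by the differential of the last coordinate, and `fibreCoord` by the same function
(`connectionForm_mul`, `fibreCoord_mul`). A smooth triangle lifts to `V (2m)`, so by Stokes' theorem
the integral of the form over it is, modulo `1 / N`, the value of the holonomy on its boundary
(`integral_eq_holonomy`). The holonomy extends linearly to chains of paths, so the integral over a
cycle vanishes modulo `1 / N`.
-/

noncomputable section

variable {n : ℕ}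

namespace V

open Polynomial

/-! ### Left translations -/

theorem one_eq_zero : (1 : V n) = 0 := rfl

/-- The linear part of the left translation by `a`: in the coordinates every left translation is
the affine map `b ↦ a + leftMap a b`. -/
def leftMap (a : V n) : V n →L[ℝ] V n :=
  (coord n).symm.toContinuousLinearMap.comp
    ((LinearMap.toContinuousLinearMap (leftLinear a)).comp (coord n).toContinuousLinearMap)

theorem mul_eq_add_leftMap (a b : V n) : a * b = a + leftMap a b := by
  apply (coord n).injective
  rw [mul_eq_add, map_add]
  rfl

theorem leftMap_mul (a b : V n) : leftMap (a * b) = (leftMap a).comp (leftMap b) := by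
  ext1 c
  have h := mul_assoc a b c
  rw [mul_eq_add_leftMap (a * b) c, mul_eq_add_leftMap b c, mul_eq_add_leftMap a (b + _),
    map_add, ← add_assoc, ← mul_eq_add_leftMap a b] at h
  exact add_left_cancel h

theorem leftMap_one : leftMap (1 : V n) = ContinuousLinearMap.id ℝ (V n) := by
  ext1 c
  have h := one_mul c
  rwa [mul_eq_add_leftMap, one_eq_zero, zero_add] at h

theorem leftMap_inv_leftMap (a b : V n) : leftMap a⁻¹ (leftMap a b) = b := by
  rw [← ContinuousLinearMap.comp_apply, ← leftMap_mul, inv_mul_cancel, leftMap_one]; rfl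

theorem leftMap_leftMap_inv (a b : V n) : leftMap a (leftMap a⁻¹ b) = b := by
  rw [← ContinuousLinearMap.comp_apply, ← leftMap_mul, mul_inv_cancel, leftMap_one]; rfl

theorem coord_leftMap (a b : V n) (j : Fin n) :
    coord n (leftMap a b) j =
      ∑ k : Fin n, coord n b k * (toPoly a ^ ((k : ℕ) + 2)).coeff (j + 2) := by
  change (∑ k : Fin n, C (coord n b k) * toPoly a ^ ((k : ℕ) + 2)).coeff ((j : ℕ) + 2) = _
  simp only [finsetSum_coeff, coeff_C_mul]

theorem leftForm_apply (k : Fin n) (g v : V n) :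
    leftForm k g v = coord n (leftMap g⁻¹ v) k := by
  have h : (fun h : V n => g⁻¹ * h) = fun h => g⁻¹ + leftMap g⁻¹ h :=
    funext fun h => mul_eq_add_leftMap _ _
  have h' : HasFDerivAt (fun h : V n => g⁻¹ + leftMap g⁻¹ h) (leftMap g⁻¹) g :=
    (leftMap g⁻¹).hasFDerivAt.const_add _
  rw [leftForm, h, h'.fderiv]
  rfl

/-- If the first `r` coordinates of `a` vanish, the powers of `x + a₁ x² + ⋯` agree with those
of `x` to the order `r`. -/
theorem coeff_toPoly_pow {a : V n} {r : ℕ} (ha : ∀ k : Fin n, (k : ℕ) < r → coord n a k = 0)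
    {s j : ℕ} (hj : j ≤ s + r) : (toPoly a ^ s).coeff j = if j = s then 1 else 0 := by
  have h1 : X ^ (r + 2) ∣ toPoly a - X := by
    rw [toPoly, add_sub_cancel_left]
    refine Finset.dvd_sum fun k _ => ?_
    rcases lt_or_ge (k : ℕ) r with hk | hk
    · simp [ha k hk]
    · exact (pow_dvd_pow X (by omega)).mul_left _
  obtain ⟨q, hq⟩ := h1
  have h2 : toPoly a = X * (1 + X ^ (r + 1) * q) := by
    rw [sub_eq_iff_eq_add.mp hq]; ring
  have h3 : X ^ (s + (r + 1)) ∣ toPoly a ^ s - X ^ s := by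
    have : toPoly a ^ s - X ^ s = X ^ s * ((1 + X ^ (r + 1) * q) ^ s - 1 ^ s) := by
      rw [h2, mul_pow]; ring
    rw [this, pow_add]
    refine mul_dvd_mul_left _ (dvd_trans ?_ (sub_dvd_pow_sub_pow _ _ s))
    simp
  rw [X_pow_dvd_iff] at h3
  have h4 := h3 j (by omega)
  rw [coeff_sub, coeff_X_pow, sub_eq_zero] at h4
  exact h4

/-- `leftMap a` is unitriangular, and its rows up to the first nonvanishing coordinate of `a` are
those of the identity. -/
theorem coord_leftMap_of_le {a : V n} {r : ℕ}
    (ha : ∀ k : Fin n, (k : ℕ) < r → coord n a k = 0) (b : V n) {j : Fin n} (hj : (j : ℕ) ≤ r) :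
    coord n (leftMap a b) j = coord n b j := by
  rw [coord_leftMap, Finset.sum_eq_single j]
  · rw [coeff_toPoly_pow ha (by omega), if_pos rfl, mul_one]
  · intro k _ hk
    rw [coeff_toPoly_pow ha (by omega), if_neg (fun h => hk (Fin.ext (by omega))), mul_zero]
  · simp

theorem coord_mul_of_le {a : V n} {r : ℕ}
    (ha : ∀ k : Fin n, (k : ℕ) < r → coord n a k = 0) (b : V n) {j : Fin n} (hj : (j : ℕ) ≤ r) :
    coord n (a * b) j = coord n a j + coord n b j := by
  rw [mul_eq_add_leftMap, map_add, Pi.add_apply, coord_leftMap_of_le ha b hj]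

theorem coord_one (j : Fin n) : coord n (1 : V n) j = 0 := rfl

theorem coord_inv_of_le {a : V n} {r : ℕ}
    (ha : ∀ k : Fin n, (k : ℕ) < r → coord n a k = 0) {j : Fin n} (hj : (j : ℕ) ≤ r) :
    coord n a⁻¹ j = - coord n a j := by
  have h := coord_mul_of_le ha a⁻¹ hj
  rw [mul_inv_cancel, coord_one] at h
  linarith

theorem coord_zpow_of_le {a : V n} {r : ℕ}
    (ha : ∀ k : Fin n, (k : ℕ) < r → coord n a k = 0) (q : ℤ) {j : Fin n} (hj : (j : ℕ) ≤ r) :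
    coord n (a ^ q) j = q * coord n a j := by
  have ha' : ∀ k : Fin n, (k : ℕ) < r → coord n a⁻¹ k = 0 := fun k hk => by
    rw [coord_inv_of_le ha hk.le, ha k hk, neg_zero]
  induction q using Int.induction_on with
  | zero => simp [coord_one]
  | succ i ih =>
    rw [add_comm, zpow_one_add, coord_mul_of_le ha _ hj, ih]; push_cast; ring
  | pred i ih =>
    rw [sub_eq_neg_add, zpow_add, zpow_neg_one, coord_mul_of_le ha' _ hj, ih,
      coord_inv_of_le ha hj]
    push_cast; ring

/-! ### The exponentials of the basis vectors -/

theorem vectorField_single (k : Fin n) (p : ℝ[X]) :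
    vectorField (Pi.single k 1) p = X ^ ((k : ℕ) + 2) * derivative p := by
  rw [vectorField, Finset.sum_eq_single k]
  · simp
  · intro b _ hb; simp [hb]
  · simp

/-- With `K = k + 1`, the field `x ^ (K + 1) d/dx` maps `x ^ (l K + 1)` to
`(l K + 1) x ^ ((l + 1) K + 1)`. -/
theorem vectorField_single_iterate (k : Fin n) (i : ℕ) :
    (vectorField (Pi.single k 1))^[i] X =
      C ((∏ l ∈ Finset.range i, (l * (k + 1) + 1) : ℕ) : ℝ) * X ^ (i * ((k : ℕ) + 1) + 1) := by
  induction i with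
  | zero => simp
  | succ i ih =>
    rw [Function.iterate_succ_apply', ih, vectorField_single, derivative_C_mul_X_pow,
      Finset.prod_range_succ, mul_left_comm, ← pow_add, Nat.cast_mul]
    congr 2
    rw [Nat.add_sub_cancel]; ring

theorem coord_expMap_single (k j : Fin n) :
    coord n (expMap (Pi.single k 1)) j =
      if (k + 1 : ℕ) ∣ j + 1 then
        ((((j + 1) / (k + 1) : ℕ).factorial : ℝ))⁻¹ *
          ((∏ l ∈ Finset.range ((j + 1) / (k + 1)), (l * (k + 1) + 1) : ℕ) : ℝ) else 0 := by
  rw [expMap, coord_ofPoly]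
  simp only [vectorField_single_iterate, finsetSum_coeff, coeff_C_mul, coeff_X_pow]
  split_ifs with h
  · obtain ⟨i, hi⟩ := h
    have hi' : ((j : ℕ) + 1) / (k + 1) = i := by rw [hi]; exact Nat.mul_div_cancel_left _ (by omega)
    have hle : i ≤ (k + 1) * i := Nat.le_mul_of_pos_left _ (by omega)
    rw [hi', Finset.sum_eq_single i]
    · rw [if_pos (by rw [mul_comm]; omega), mul_one]
    · intro b _ hb
      rw [if_neg, mul_zero, mul_zero]
      intro h
      apply hb
      have : (k + 1 : ℕ) * b = (k + 1) * i := by rw [mul_comm (k + 1 : ℕ) b]; omega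
      exact Nat.eq_of_mul_eq_mul_left (by omega) this
    · intro h
      exact absurd (Finset.mem_range.mpr (by omega)) h
  · refine Finset.sum_eq_zero fun i _ => ?_
    rw [if_neg, mul_zero, mul_zero]
    intro h'
    exact h ⟨i, by rw [mul_comm]; omega⟩

theorem coord_expMap_single_of_lt {k j : Fin n} (h : j < k) :
    coord n (expMap (Pi.single k 1)) j = 0 := by
  rw [coord_expMap_single, if_neg]
  intro h'
  have := Nat.le_of_dvd (by omega) h'
  omega

theorem coord_expMap_single_self (k : Fin n) : coord n (expMap (Pi.single k 1)) k = 1 := by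
  simp [coord_expMap_single]

/-! ### The reduction to a fundamental box -/

/-- Left multiplication by a power of `exp e_{r+1}` changes the coordinate `a_{r+1}` by an integer
and leaves the earlier coordinates alone, so the coordinates can be moved to `[0, 1]` one after
the other. -/
theorem exists_mul_mem_box (g : V n) :
    ∃ γ ∈ latticeΓ n, ∀ k, coord n (γ * g) k ∈ Set.Icc (0 : ℝ) 1 := by
  suffices H : ∀ r ≤ n, ∃ γ ∈ latticeΓ n, ∀ k : Fin n, (k : ℕ) < r →
      coord n (γ * g) k ∈ Set.Icc (0 : ℝ) 1 by
    obtain ⟨γ, hγ, h⟩ := H n le_rfl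
    exact ⟨γ, hγ, fun k => h k k.2⟩
  intro r
  induction r with
  | zero => exact fun _ => ⟨1, one_mem _, fun k hk => absurd hk (by omega)⟩
  | succ r ih =>
    intro hr
    obtain ⟨γ, hγ, h⟩ := ih (by omega)
    let c : V n := expMap (Pi.single ⟨r, hr⟩ 1)
    have hc : ∀ k : Fin n, (k : ℕ) < r → coord n c k = 0 := fun k hk =>
      coord_expMap_single_of_lt hk
    have hcq : ∀ q : ℤ, ∀ k : Fin n, (k : ℕ) < r → coord n (c ^ q) k = 0 := fun q k hk => by
      rw [coord_zpow_of_le hc q hk.le, hc k hk, mul_zero]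
    have hcΓ : c ∈ latticeΓ n := Subgroup.subset_closure ⟨⟨r, hr⟩, rfl⟩
    refine ⟨c ^ (-⌊coord n (γ * g) ⟨r, hr⟩⌋) * γ, mul_mem (zpow_mem hcΓ _) hγ, fun k hk => ?_⟩
    rw [mul_assoc, coord_mul_of_le (hcq _) _ (Nat.lt_succ_iff.mp hk)]
    rcases Nat.lt_succ_iff_lt_or_eq.mp hk with hk | hk
    · rw [hcq _ k hk, zero_add]
      exact h k hk
    · obtain rfl : k = ⟨r, hr⟩ := Fin.ext hk
      rw [coord_zpow_of_le hc _ le_rfl, coord_expMap_single_self, mul_one]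
      push_cast
      constructor
      · linarith [Int.floor_le (coord n (γ * g) ⟨r, hr⟩)]
      · linarith [Int.lt_floor_add_one (coord n (γ * g) ⟨r, hr⟩)]

/-! ### A lattice with bounded denominators -/

/-- The integer points of `V n` form a subgroup. -/
def integerPoints (n : ℕ) : Subgroup (V n) where
  carrier := {a | ∀ k, ∃ z : ℤ, coord n a k = z}
  one_mem' k := ⟨0, by simp [coord_one]⟩
  mul_mem' := by
    intro a b ha hb
    have key : ∀ c : V n, (∀ k, ∃ z : ℤ, coord n c k = z) →
        ∃ q : ℤ[X], q.map (Int.castRingHom ℝ) = toPoly c := by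
      intro c hc
      choose z hz using hc
      exact ⟨X + ∑ k : Fin n, C (z k) * X ^ ((k : ℕ) + 2),
        by simp [toPoly, Polynomial.map_sum, hz]⟩
    obtain ⟨p, hp⟩ := key a ha
    obtain ⟨q, hq⟩ := key b hb
    intro k
    exact ⟨(q.comp p).coeff (k + 2), by
      rw [mul_def, coord_ofPoly, ← hp, ← hq, ← Polynomial.map_comp, coeff_map]; rfl⟩
  inv_mem' := by
    intro a ha
    choose z hz using ha
    have hp : (X + ∑ k : Fin n, C (z k) * X ^ ((k : ℕ) + 2) : ℤ[X]).map (Int.castRingHom ℝ)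
        = toPoly a := by simp [toPoly, Polynomial.map_sum, hz]
    set p : ℤ[X] := X + ∑ k : Fin n, C (z k) * X ^ ((k : ℕ) + 2)
    suffices H : ∀ r : ℕ, ∀ k : Fin n, (k : ℕ) = r → ∃ y : ℤ, coord n a⁻¹ k = y from
      fun k => H k k rfl
    intro r
    induction r using Nat.strong_induction_on with
    | _ r ih =>
      rintro k rfl
      have hex : ∀ j : Fin n, ∃ y : ℤ, j ≠ k →
          coord n a⁻¹ j * (toPoly a ^ ((j : ℕ) + 2)).coeff (k + 2) = y := by
        intro j
        rcases lt_trichotomy j k with h | h | h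
        · obtain ⟨y, hy⟩ := ih j h j rfl
          refine ⟨y * (p ^ ((j : ℕ) + 2)).coeff (k + 2), fun _ => ?_⟩
          rw [hy, ← hp, ← Polynomial.map_pow, coeff_map]
          push_cast; rfl
        · exact ⟨0, fun hj => absurd h hj⟩
        · refine ⟨0, fun _ => ?_⟩
          rw [coeff_toPoly_pow (r := 0) (fun _ h => absurd h (Nat.not_lt_zero _)) (by omega),
            if_neg (by omega), mul_zero, Int.cast_zero]
      choose y hy using hex
      have h : coord n (a * a⁻¹) k = 0 := by rw [mul_inv_cancel]; rfl
      rw [mul_eq_add_leftMap, map_add, Pi.add_apply, coord_leftMap,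
        ← Finset.add_sum_erase _ _ (Finset.mem_univ k),
        coeff_toPoly_pow (r := 0) (fun _ h => absurd h (Nat.not_lt_zero _)) (by omega),
        if_pos rfl, mul_one, Finset.sum_congr rfl fun j hj => hy j (Finset.ne_of_mem_erase hj),
        hz] at h
      exact ⟨-z k - ∑ j ∈ Finset.univ.erase k, y j, by push_cast; linarith⟩

theorem toPoly_dilation {d : ℝ} (hd : d ≠ 0) (a : V n) :
    toPoly ((coord n).symm fun k => d ^ ((k : ℕ) + 1) * coord n a k)
      = C d⁻¹ * (toPoly a).comp (C d * X) := by
  ext j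
  rw [coeff_C_mul, comp_C_mul_X_coeff, coeff_toPoly, coeff_toPoly, add_mul, mul_add,
    Finset.sum_mul, Finset.mul_sum]
  congr 1
  · split_ifs with h
    · rw [h, one_mul, pow_one, inv_mul_cancel₀ hd]
    · simp
  · refine Finset.sum_congr rfl fun k _ => ?_
    split_ifs with h
    · change d ^ ((k : ℕ) + 1) * coord n a k = _
      rw [h]
      field_simp
      ring
    · simp

/-- The automorphism of `V n` given by the conjugation with the dilation `x ↦ d x`. -/
def dilation (d : ℝ) (hd : d ≠ 0) : V n →* V n :=
  MonoidHom.mk' (fun a => (coord n).symm fun k => d ^ ((k : ℕ) + 1) * coord n a k) <| by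
    intro a b
    ext j
    have h : ((toPoly ((coord n).symm fun k => d ^ ((k : ℕ) + 1) * coord n b k)).comp
        (toPoly ((coord n).symm fun k => d ^ ((k : ℕ) + 1) * coord n a k)))
        = C d⁻¹ * ((toPoly b).comp (toPoly a)).comp (C d * X) := by
      rw [toPoly_dilation hd, toPoly_dilation hd, mul_comp, C_comp, comp_assoc, mul_comp, C_comp,
        X_comp, ← mul_assoc (C d), ← C_mul, mul_inv_cancel₀ hd, C_1, one_mul, ← comp_assoc]
    change d ^ ((j : ℕ) + 1) * ((toPoly b).comp (toPoly a)).coeff (j + 2) =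
      Polynomial.coeff (Polynomial.comp _ _) _
    rw [h, coeff_C_mul, comp_C_mul_X_coeff]
    field_simp
    ring

theorem coord_dilation (d : ℝ) (hd : d ≠ 0) (a : V n) (k : Fin n) :
    coord n (dilation d hd a) k = d ^ ((k : ℕ) + 1) * coord n a k := rfl

/-- The coordinates of the elements of the lattice have bounded denominators. -/
theorem exists_int_of_mem_latticeΓ {a : V n} (ha : a ∈ latticeΓ n) (k : Fin n) :
    ∃ z : ℤ, (n.factorial : ℝ) ^ ((k : ℕ) + 1) * coord n a k = z := by
  have hd : (n.factorial : ℝ) ≠ 0 := by exact_mod_cast n.factorial_ne_zero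
  suffices latticeΓ n ≤ (integerPoints n).comap (dilation (n.factorial : ℝ) hd) from this ha k
  rw [latticeΓ, Subgroup.closure_le]
  rintro _ ⟨i, rfl⟩ j
  rw [coord_dilation, coord_expMap_single]
  split_ifs with h
  · set q := ((j : ℕ) + 1) / (i + 1)
    have hq : q ≤ n := (Nat.div_le_self _ _).trans (by omega)
    obtain ⟨w, hw⟩ := Nat.factorial_dvd_factorial hq
    refine ⟨n.factorial ^ (j : ℕ) * w * (∏ l ∈ Finset.range q, (l * (i + 1) + 1) : ℕ), ?_⟩
    have hq0 : (q.factorial : ℝ) ≠ 0 := by exact_mod_cast q.factorial_ne_zero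
    rw [pow_succ]
    nth_rw 2 [hw]
    push_cast
    field_simp
    simp only [mul_comm]
  · exact ⟨0, by simp⟩

/-! ### The central extension `V (n + 1) → V n` -/

/-- The reduction modulo `x ^ (n + 2)`, as a linear map in the coordinates. -/
def truncate (n : ℕ) : V (n + 1) →L[ℝ] V n :=
  (coord n).symm.toContinuousLinearMap.comp <|
    (ContinuousLinearMap.pi fun k : Fin n =>
      ContinuousLinearMap.proj (R := ℝ) (φ := fun _ : Fin (n + 1) => ℝ) k.castSucc).comp
    (coord (n + 1)).toContinuousLinearMap

/-- The linear section of the reduction with vanishing last coordinate. -/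
def extend (n : ℕ) : V n →L[ℝ] V (n + 1) :=
  (coord (n + 1)).symm.toContinuousLinearMap.comp <|
    (ContinuousLinearMap.pi (Fin.snoc (α := fun _ => (Fin n → ℝ) →L[ℝ] ℝ)
      (fun k : Fin n => ContinuousLinearMap.proj (R := ℝ) (φ := fun _ : Fin n => ℝ) k) 0)).comp
    (coord n).toContinuousLinearMap

/-- The last coordinate on `V (n + 1)`. -/
def lastCoord (n : ℕ) : V (n + 1) →L[ℝ] ℝ :=
  (ContinuousLinearMap.proj (R := ℝ) (φ := fun _ : Fin (n + 1) => ℝ) (Fin.last n)).comp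
    (coord (n + 1)).toContinuousLinearMap

/-- The element `x + z x ^ (n + 2)` of the centre of `V (n + 1)`. -/
def central (n : ℕ) (z : ℝ) : V (n + 1) := (coord (n + 1)).symm (Pi.single (Fin.last n) z)

theorem coord_truncate (a : V (n + 1)) (k : Fin n) :
    coord n (truncate n a) k = coord (n + 1) a k.castSucc := rfl

theorem coord_extend_castSucc (a : V n) (k : Fin n) :
    coord (n + 1) (extend n a) k.castSucc = coord n a k := by
  change (Fin.snoc (α := fun _ => (Fin n → ℝ) →L[ℝ] ℝ) _ _ k.castSucc) (coord n a) = _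
  rw [Fin.snoc_castSucc]; rfl

theorem lastCoord_apply (a : V (n + 1)) : lastCoord n a = coord (n + 1) a (Fin.last n) := rfl

theorem lastCoord_extend (a : V n) : lastCoord n (extend n a) = 0 := by
  change (Fin.snoc (α := fun _ => (Fin n → ℝ) →L[ℝ] ℝ) _ _ (Fin.last n)) (coord n a) = _
  rw [Fin.snoc_last]; rfl

theorem truncate_extend (a : V n) : truncate n (extend n a) = a := by
  ext k; rw [coord_truncate, coord_extend_castSucc]

theorem coord_central_castSucc (z : ℝ) (k : Fin n) :
    coord (n + 1) (central n z) k.castSucc = 0 := by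
  rw [central, ContinuousLinearEquiv.apply_symm_apply,
    Pi.single_eq_of_ne (Fin.castSucc_lt_last k).ne]

theorem lastCoord_central (z : ℝ) : lastCoord n (central n z) = z := by
  rw [lastCoord_apply, central, ContinuousLinearEquiv.apply_symm_apply, Pi.single_eq_same]

theorem eq_extend_add_central (a : V (n + 1)) :
    a = extend n (truncate n a) + central n (lastCoord n a) := by
  ext k
  rw [map_add, Pi.add_apply]
  induction k using Fin.lastCases with
  | last =>
    rw [← lastCoord_apply, ← lastCoord_apply, ← lastCoord_apply, lastCoord_extend,
      lastCoord_central, zero_add]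
  | cast k => rw [coord_extend_castSucc, coord_central_castSucc, coord_truncate, add_zero]

theorem truncate_mul (a b : V (n + 1)) : truncate n (a * b) = truncate n a * truncate n b := by
  have h : ∀ c : V (n + 1), X ^ (n + 2) ∣ toPoly c - toPoly (truncate n c) := by
    intro c
    have : toPoly c - toPoly (truncate n c)
        = C (coord (n + 1) c (Fin.last n)) * X ^ (n + 2) := by
      simp only [toPoly, Fin.sum_univ_castSucc, coord_truncate, Fin.val_castSucc, Fin.val_last]
      ring
    rw [this]
    exact dvd_mul_left _ _
  have h1 : truncate n (a * b) = ofPoly n ((toPoly b).comp (toPoly a)) := rfl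
  rw [h1, mul_def]
  apply ofPoly_congr
  rw [← sub_add_sub_cancel _ ((toPoly (truncate n b)).comp (toPoly a))]
  exact dvd_add (comp_congr_left (h b) (X_dvd_toPoly a)) ((h a).trans (comp_congr_right _ _ _))

/-- The reduction modulo `x ^ (n + 2)` as a homomorphism. -/
def truncateHom (n : ℕ) : V (n + 1) →* V n := MonoidHom.mk' (truncate n) truncate_mul

theorem truncateHom_apply (a : V (n + 1)) : truncateHom n a = truncate n a := rfl

theorem truncate_leftMap (a b : V (n + 1)) :
    truncate n (leftMap a b) = leftMap (truncate n a) (truncate n b) := by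
  have h := truncate_mul a b
  rw [mul_eq_add_leftMap, mul_eq_add_leftMap, map_add] at h
  exact add_left_cancel h

theorem truncate_inv (a : V (n + 1)) : truncate n a⁻¹ = (truncate n a)⁻¹ :=
  map_inv (truncateHom n) a

theorem leftMap_central (z : ℝ) :
    leftMap (central n z) = ContinuousLinearMap.id ℝ (V (n + 1)) := by
  ext1 b
  ext j
  refine coord_leftMap_of_le (r := n) (fun k hk => ?_) b (by omega)
  exact coord_central_castSucc z ⟨k, hk⟩

theorem leftMap_apply_central (a : V (n + 1)) (z : ℝ) :
    leftMap a (central n z) = central n z := by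
  ext j
  rw [coord_leftMap, Fin.sum_univ_castSucc]
  simp only [coord_central_castSucc, zero_mul, Finset.sum_const_zero, zero_add]
  rw [coeff_toPoly_pow (r := 0) (fun _ h => absurd h (Nat.not_lt_zero _))
    (by simp only [Fin.val_last]; omega)]
  induction j using Fin.lastCases with
  | last => simp
  | cast j =>
    rw [if_neg (by simp only [Fin.val_last, Fin.val_castSucc]; omega), mul_zero,
      coord_central_castSucc]

theorem mul_central (a : V (n + 1)) (z : ℝ) : a * central n z = a + central n z := by
  rw [mul_eq_add_leftMap, leftMap_apply_central]

theorem central_mul (a : V (n + 1)) (z : ℝ) : central n z * a = a + central n z := by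
  rw [mul_eq_add_leftMap, leftMap_central]; exact add_comm _ _

theorem eq_central_of_truncate_eq_one {a : V (n + 1)} (h : truncate n a = 1) :
    a = central n (lastCoord n a) := by
  conv_lhs => rw [eq_extend_add_central a, h, one_eq_zero, map_zero, zero_add]

/-- The reduction maps the generator `exp e_k` to `exp e_k` for `k ≤ n`, and `exp e_{n+1}`
to `1`. -/
theorem map_latticeΓ (n : ℕ) : (latticeΓ (n + 1)).map (truncateHom n) = latticeΓ n := by
  have h1 : ∀ k : Fin n, truncateHom n (expMap (Pi.single k.castSucc 1)) =
      expMap (Pi.single k 1) := by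
    intro k
    ext j
    rw [truncateHom_apply, coord_truncate, coord_expMap_single, coord_expMap_single]
    rfl
  have h2 : truncateHom n (expMap (Pi.single (Fin.last n) 1)) = 1 := by
    ext j
    rw [truncateHom_apply, coord_truncate, coord_expMap_single_of_lt (Fin.castSucc_lt_last j)]
    rfl
  rw [latticeΓ, latticeΓ, MonoidHom.map_closure]
  apply le_antisymm
  · rw [Subgroup.closure_le]
    rintro _ ⟨_, ⟨k, rfl⟩, rfl⟩
    induction k using Fin.lastCases with
    | last => simp only [h2]; exact one_mem _
    | cast k => simp only [h1]; exact Subgroup.subset_closure ⟨k, rfl⟩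
  · apply Subgroup.closure_mono
    rintro _ ⟨k, rfl⟩
    exact ⟨_, ⟨k.castSucc, rfl⟩, h1 k⟩

/-! ### Smoothness of the group operations -/

theorem contDiff_coord (k : Fin n) : ContDiff ℝ ∞ fun a : V n => coord n a k :=
  (contDiff_apply ℝ ℝ k).comp (coord n).contDiff

theorem contDiff_coeff_toPoly_pow (s j : ℕ) :
    ContDiff ℝ ∞ fun a : V n => (toPoly a ^ s).coeff j := by
  induction s generalizing j with
  | zero => simp only [pow_zero]; exact contDiff_const
  | succ s ih =>
    simp only [pow_succ, coeff_mul, coeff_toPoly]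
    refine ContDiff.sum fun p _ => (ih p.1).mul (contDiff_const.add (ContDiff.sum fun k _ => ?_))
    split_ifs
    · exact contDiff_coord k
    · exact contDiff_const

theorem contDiff_leftMap : ContDiff ℝ ∞ (leftMap : V n → V n →L[ℝ] V n) := by
  rw [contDiff_clm_apply_iff]
  intro b
  rw [← (coord n).comp_contDiff_iff, contDiff_pi]
  intro j
  simp only [Function.comp_apply, coord_leftMap]
  exact ContDiff.sum fun k _ => contDiff_const.mul (contDiff_coeff_toPoly_pow _ _)

/-- The Maurer–Cartan form of `V n`: its value at `g` is the differential at `g` of the left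
translation by `g⁻¹`. -/
def maurerCartan (g : V n) : V n →L[ℝ] V n := leftMap g⁻¹

theorem contDiff_maurerCartan : ContDiff ℝ ∞ (maurerCartan : V n → V n →L[ℝ] V n) := by
  have h : (maurerCartan : V n → V n →L[ℝ] V n) = fun g => Ring.inverse (leftMap g) := by
    funext g
    let u : (V n →L[ℝ] V n)ˣ := ⟨leftMap g, leftMap g⁻¹,
      ContinuousLinearMap.ext (leftMap_leftMap_inv g),
      ContinuousLinearMap.ext (leftMap_inv_leftMap g)⟩
    exact (Ring.inverse_unit u).symm
  rw [h, contDiff_iff_contDiffAt]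
  intro g
  let u : (V n →L[ℝ] V n)ˣ := ⟨leftMap g, leftMap g⁻¹,
    ContinuousLinearMap.ext (leftMap_leftMap_inv g),
    ContinuousLinearMap.ext (leftMap_inv_leftMap g)⟩
  exact (contDiffAt_ringInverse ℝ u).comp g contDiff_leftMap.contDiffAt

theorem inv_eq_neg_maurerCartan (g : V n) : g⁻¹ = -maurerCartan g g := by
  have h := inv_mul_cancel g
  rw [mul_eq_add_leftMap, one_eq_zero] at h
  exact eq_neg_of_add_eq_zero_left h

instance : IsTopologicalGroup (V n) where
  continuous_mul := by
    simp only [mul_eq_add_leftMap]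
    exact continuous_fst.add
      ((contDiff_leftMap.continuous.comp continuous_fst).clm_apply continuous_snd)
  continuous_inv := by
    simp only [inv_eq_neg_maurerCartan]
    exact (contDiff_maurerCartan.continuous.clm_apply continuous_id).neg

theorem hasFDerivAt_mul_left (g h : V n) : HasFDerivAt (fun b : V n => g * b) (leftMap g) h := by
  simp only [mul_eq_add_leftMap]
  exact (leftMap g).hasFDerivAt.const_add _

theorem contDiff_mul_left (g : V n) : ContDiff ℝ ∞ fun b : V n => g * b := by
  simp only [mul_eq_add_leftMap]
  exact contDiff_const.add (leftMap g).contDiff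

/-! ### The Maurer–Cartan equation -/

/-- The bilinear map `(v, w) ↦ v w'` on vector fields modulo `x ^ (n + 2)`, obtained as the
derivative of `leftMap` at the unit; its antisymmetrization is the Lie bracket. -/
def infinitesimalMap (n : ℕ) : V n →L[ℝ] V n →L[ℝ] V n := fderiv ℝ leftMap 1

/-- The derivative of the homomorphism `leftMap` at `g`, in a left-translated direction, is
determined by its derivative at the unit. -/
theorem fderiv_leftMap (g v : V n) :
    fderiv ℝ leftMap g (leftMap g v) = (leftMap g).comp (infinitesimalMap n v) := by
  have hd : ∀ a : V n, HasFDerivAt leftMap (fderiv ℝ leftMap a) a := fun a =>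
    (contDiff_leftMap.differentiable (by simp) a).hasFDerivAt
  have h1 : HasFDerivAt (fun b : V n => leftMap (g * b))
      ((fderiv ℝ leftMap g).comp (leftMap g)) 1 := by
    have := hd (g * 1)
    rw [mul_one] at this
    exact HasFDerivAt.comp (1 : V n) (by rwa [mul_one]) (hasFDerivAt_mul_left g 1)
  have h2 : HasFDerivAt (fun b : V n => leftMap (g * b))
      ((ContinuousLinearMap.compL ℝ (V n) (V n) (V n) (leftMap g)).comp
        (fderiv ℝ leftMap 1)) 1 := by
    simp only [leftMap_mul]
    exact (ContinuousLinearMap.compL ℝ (V n) (V n) (V n) (leftMap g)).hasFDerivAt.comp 1 (hd 1)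
  exact congrArg (fun L => L v) (h1.unique h2)

/-- The Maurer–Cartan equation, before antisymmetrization. -/
theorem fderiv_maurerCartan (g v w : V n) :
    fderiv ℝ maurerCartan g v w =
      -infinitesimalMap n (maurerCartan g v) (maurerCartan g w) := by
  have hl : HasFDerivAt leftMap (fderiv ℝ leftMap g) g :=
    (contDiff_leftMap.differentiable (by simp) g).hasFDerivAt
  have hm : HasFDerivAt maurerCartan (fderiv ℝ maurerCartan g) g :=
    (contDiff_maurerCartan.differentiable (by simp) g).hasFDerivAt
  have h1 := hl.clm_comp hm
  have h2 : HasFDerivAt (fun y : V n => (leftMap y).comp (maurerCartan y))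
      (0 : V n →L[ℝ] V n →L[ℝ] V n) g := by
    have : (fun y : V n => (leftMap y).comp (maurerCartan y))
        = fun _ => ContinuousLinearMap.id ℝ (V n) :=
      funext fun y => ContinuousLinearMap.ext (leftMap_leftMap_inv y)
    rw [this]
    exact hasFDerivAt_const _ _
  have h3 := congrArg (fun L => L v w) (h1.unique h2)
  simp only [add_apply, ContinuousLinearMap.comp_apply,
    ContinuousLinearMap.compL_apply, ContinuousLinearMap.flip_apply,
    zero_apply] at h3
  have h4 : fderiv ℝ leftMap g v (maurerCartan g w)
      = leftMap g (infinitesimalMap n (maurerCartan g v) (maurerCartan g w)) := by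
    have := fderiv_leftMap g (maurerCartan g v)
    rw [maurerCartan, leftMap_leftMap_inv] at this
    rw [this]; rfl
  rw [h4, ← map_add] at h3
  have h5 := congrArg (leftMap g⁻¹) h3
  rw [leftMap_inv_leftMap, map_zero] at h5
  exact eq_neg_of_add_eq_zero_left h5

/-- The derivative of `(x + t v(x)) ^ s` at `t = 0` is `s x ^ (s - 1) v(x)`. -/
theorem hasDerivAt_coeff_toPoly_pow (v : V n) (s j : ℕ) :
    HasDerivAt (fun t : ℝ => (toPoly (t • v) ^ s).coeff j)
      ((C (s : ℝ) * X ^ (s - 1) * (toPoly v - X)).coeff j) 0 := by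
  have hlin : ∀ t : ℝ, toPoly (t • v) = X + C t * (toPoly v - X) := by
    intro t
    simp [toPoly, Finset.mul_sum, mul_assoc]
  simp only [hlin]
  induction s generalizing j with
  | zero => simpa using hasDerivAt_const (0 : ℝ) _
  | succ s ih =>
    have h : ∀ i, HasDerivAt (fun t : ℝ => (X + C t * (toPoly v - X)).coeff i)
        ((toPoly v - X).coeff i) 0 := by
      intro i
      simp only [coeff_add, coeff_C_mul]
      simpa only [id, one_mul] using
        ((hasDerivAt_id (0 : ℝ)).mul_const ((toPoly v - X).coeff i)).const_add ((X : ℝ[X]).coeff i)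
    simp only [pow_succ, coeff_mul _ (X + _)]
    refine (HasDerivAt.fun_sum fun p _ => (ih p.1).mul (h p.2)).congr_deriv ?_
    simp only [C_0, zero_mul, add_zero]
    rw [Finset.sum_add_distrib, ← coeff_mul, ← coeff_mul, ← coeff_add]
    congr 1
    rcases s with _ | s
    · simp
    · simp only [Nat.add_sub_cancel, Nat.cast_add, Nat.cast_one, C_add, C_1]
      ring

theorem lastCoord_infinitesimalMap (v w : V (n + 1)) :
    lastCoord n (infinitesimalMap (n + 1) v w) =
      ∑ k : Fin n, ((k : ℝ) + 2) * coord n (truncate n w) k * coord n (truncate n v) k.rev := by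
  have h1 : HasDerivAt (fun t : ℝ => lastCoord n (leftMap (t • v) w))
      (lastCoord n (infinitesimalMap (n + 1) v w)) 0 := by
    have hl : HasFDerivAt (leftMap : V (n + 1) → _) (infinitesimalMap (n + 1)) ((0 : ℝ) • v) := by
      rw [zero_smul]
      exact (contDiff_leftMap.differentiable (by simp) (1 : V (n + 1))).hasFDerivAt
    have h := hl.comp_hasDerivAt (0 : ℝ) ((hasDerivAt_id (0 : ℝ)).smul_const v)
    have h' := (h.clm_apply (hasDerivAt_const (0 : ℝ) w))
    have h'' : HasDerivAt (fun t : ℝ => lastCoord n (leftMap (t • v) w)) _ 0 :=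
      (lastCoord n).hasFDerivAt.comp_hasDerivAt (0 : ℝ) h'
    refine h''.congr_deriv ?_
    simp
  have h2 : HasDerivAt (fun t : ℝ => lastCoord n (leftMap (t • v) w))
      (∑ k : Fin (n + 1), coord (n + 1) w k *
        (C (((k : ℕ) + 2 : ℕ) : ℝ) * X ^ ((k : ℕ) + 2 - 1) * (toPoly v - X)).coeff (n + 2)) 0 := by
    simp only [lastCoord_apply, coord_leftMap, Fin.val_last]
    exact HasDerivAt.fun_sum fun k _ => (hasDerivAt_coeff_toPoly_pow v _ _).const_mul _
  rw [h1.unique h2, Fin.sum_univ_castSucc]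
  -- The last term would involve the coefficient of `x` in `v`, which vanishes.
  have hlast : (C (((Fin.last n : ℕ) + 2 : ℕ) : ℝ) * X ^ ((Fin.last n : ℕ) + 2 - 1) *
      (toPoly v - X)).coeff (n + 2) = 0 := by
    rw [mul_assoc, coeff_C_mul, coeff_X_pow_mul', if_pos (by simp only [Fin.val_last]; omega),
      coeff_sub, Fin.val_last, show n + 2 - (n + 2 - 1) = 1 by omega, coeff_toPoly_one,
      coeff_X_one, sub_self, mul_zero]
  rw [hlast, mul_zero, add_zero]
  refine Finset.sum_congr rfl fun k _ => ?_
  have hk : n + 2 - ((k : ℕ) + 2 - 1) = (k.rev : ℕ) + 2 := by rw [Fin.val_rev]; omega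
  have hc : (toPoly v - X).coeff ((k.rev : ℕ) + 2) = coord n (truncate n v) k.rev := by
    rw [coeff_sub, coeff_X, if_neg (by omega), sub_zero, coord_truncate]
    exact congrFun (congrArg (coord (n + 1)) (ofPoly_toPoly v)) k.rev.castSucc
  rw [mul_assoc (C _), coeff_C_mul, coeff_X_pow_mul', Fin.val_castSucc, if_pos (by omega), hk, hc,
    coord_truncate w]
  push_cast
  ring

/-! ### The form `formΩ` and its primitive -/

theorem leftForm_eq (k : Fin n) (g v : V n) :
    leftForm k g v = coord n (maurerCartan g v) k := leftForm_apply k g v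

theorem maurerCartan_mul (γ g v : V n) :
    maurerCartan (γ * g) (leftMap γ v) = maurerCartan g v := by
  rw [maurerCartan, mul_inv_rev, leftMap_mul, ContinuousLinearMap.comp_apply, leftMap_inv_leftMap]
  rfl

theorem sum_fin_two_mul (m : ℕ) (f : Fin (2 * m) → ℝ) :
    ∑ k, f k = ∑ i : Fin m, (f (Fin.castLE (by omega) i) + f (Fin.castLE (by omega) i).rev) := by
  rw [← (finCongr (two_mul m)).symm.sum_comp, Fin.sum_univ_add, Finset.sum_add_distrib]
  congr 1
  rw [← Equiv.sum_comp Fin.revPerm]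
  refine Finset.sum_congr rfl fun i _ => congrArg f (Fin.ext ?_)
  simp [Fin.val_rev]
  omega

/-- `formΩ` as a sum over all indices: the pair `{i, 2m + 1 - i}` contributes the two terms of
`ω_i ∧ ω_{2m+1-i}`. -/
theorem formΩ_apply (m : ℕ) (g v w : V (2 * m)) :
    formΩ m g ![v, w] = ∑ k : Fin (2 * m), (2 * (k : ℝ) + 1 - 2 * m) *
      (coord _ (maurerCartan g w) k * coord _ (maurerCartan g v) k.rev) := by
  rw [formΩ, sum_fin_two_mul, ContinuousAlternatingMap.sum_apply]
  refine Finset.sum_congr rfl fun i _ => ?_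
  rw [ContinuousAlternatingMap.smul_apply, wedgeOne_apply, Fin.rev_rev]
  simp only [leftForm_eq, smul_eq_mul]
  have h : ((Fin.castLE (show m ≤ 2 * m by omega) i).rev : ℝ) = 2 * m - 1 - i := by
    rw [Fin.val_rev, Fin.val_castLE, Nat.cast_sub (by omega)]
    push_cast
    ring
  rw [h, Fin.val_castLE]
  ring

/-- `formΩ` is invariant under left translations. -/
theorem formΩ_mul (m : ℕ) (γ g v w : V (2 * m)) :
    formΩ m (γ * g) ![leftMap γ v, leftMap γ w] = formΩ m g ![v, w] := by
  simp only [formΩ_apply, maurerCartan_mul]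

theorem formΩ_nondegenerate (m : ℕ) (g v : V (2 * m)) (h : ∀ w, formΩ m g ![v, w] = 0) :
    v = 0 := by
  have h1 : maurerCartan g v = 0 := by
    ext j
    -- Pairing with the left-invariant field of index `j.rev` isolates the component `j`, with the
    -- odd coefficient `2 j.rev + 1 - 2m`.
    have h2 := h (leftMap g ((coord _).symm (Pi.single j.rev 1)))
    have h3 : maurerCartan g (leftMap g ((coord _).symm (Pi.single j.rev 1))) =
        (coord _).symm (Pi.single j.rev 1) := leftMap_inv_leftMap _ _
    rw [formΩ_apply, h3, ContinuousLinearEquiv.apply_symm_apply,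
      Finset.sum_eq_single j.rev (fun k _ hk => by rw [Pi.single_eq_of_ne hk]; ring) (by simp),
      Pi.single_eq_same, one_mul, Fin.rev_rev] at h2
    refine (mul_eq_zero.mp h2).resolve_left fun h4 => ?_
    have h5 : (2 * (j.rev : ℕ) + 1 : ℤ) = 2 * m := by
      have : (2 * ((j.rev : ℕ) : ℝ) + 1) = 2 * m := by linarith
      exact_mod_cast this
    omega
  rw [← leftMap_leftMap_inv g v]
  change leftMap g (maurerCartan g v) = 0
  rw [h1, map_zero]

/-- A connection form of the central extension `V (n + 1) → V n`: minus the left-invariant form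
`ω_{n+1}`, restricted to the section `extend`. -/
def connectionForm (n : ℕ) (a : V n) : V n →L[ℝ] ℝ :=
  -(lastCoord n).comp ((maurerCartan (extend n a)).comp (extend n))

theorem connectionForm_apply (a v : V n) :
    connectionForm n a v = -lastCoord n (maurerCartan (extend n a) (extend n v)) := rfl

theorem contDiff_connectionForm : ContDiff ℝ ∞ (connectionForm n) :=
  (contDiff_const.clm_comp
    ((contDiff_maurerCartan.comp (extend n).contDiff).clm_comp contDiff_const)).neg

theorem fderiv_connectionForm (a v w : V n) :
    fderiv ℝ (connectionForm n) a v w =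
      ∑ k : Fin n, ((k : ℝ) + 2) *
        (coord n (maurerCartan a w) k * coord n (maurerCartan a v) k.rev) := by
  have htr : ∀ u : V n, truncate n (maurerCartan (extend n a) (extend n u)) = maurerCartan a u := by
    intro u
    rw [maurerCartan, truncate_leftMap, truncate_inv, truncate_extend, truncate_extend]
    rfl
  have h1 : HasFDerivAt (fun b : V n => maurerCartan (extend n b))
      ((fderiv ℝ maurerCartan (extend n a)).comp (extend n)) a :=
    ((contDiff_maurerCartan.differentiable (by simp) _).hasFDerivAt).comp a (extend n).hasFDerivAt
  have h2 : HasFDerivAt (fun b : V n => connectionForm n b w)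
      (-(lastCoord n).comp ((((fderiv ℝ maurerCartan (extend n a)).comp (extend n))).flip
        (extend n w))) a := by
    have := h1.clm_apply (hasFDerivAt_const (extend n w) a)
    refine HasFDerivAt.congr_fderiv ((lastCoord n).hasFDerivAt.comp a this).neg ?_
    ext v
    simp
  have h3 : HasFDerivAt (fun b : V n => connectionForm n b w)
      ((fderiv ℝ (connectionForm n) a).flip w) a := by
    have := ((contDiff_connectionForm (n := n)).differentiable (by simp) a).hasFDerivAt.clm_apply
      (hasFDerivAt_const w a)
    refine this.congr_fderiv ?_
    ext v
    simp
  have h4 := congrArg (fun L => L v) (h3.unique h2)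
  simp only [ContinuousLinearMap.flip_apply, neg_apply, ContinuousLinearMap.comp_apply,
    fderiv_maurerCartan, map_neg, neg_neg, lastCoord_infinitesimalMap, htr] at h4
  rw [h4]
  exact Finset.sum_congr rfl fun k _ => by ring

/-- `formΩ` is the curvature of the central extension `V (2m + 1) → V (2m)`. -/
theorem formΩ_eq_fderiv (m : ℕ) (a v w : V (2 * m)) :
    formΩ m a ![v, w] =
      fderiv ℝ (connectionForm (2 * m)) a v w - fderiv ℝ (connectionForm (2 * m)) a w v := by
  have h : fderiv ℝ (connectionForm (2 * m)) a w v = ∑ k : Fin (2 * m), (2 * m + 1 - (k : ℝ)) *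
      (coord _ (maurerCartan a w) k * coord _ (maurerCartan a v) k.rev) := by
    rw [fderiv_connectionForm, ← Equiv.sum_comp Fin.revPerm]
    refine Finset.sum_congr rfl fun k _ => ?_
    have h : (k.rev : ℝ) = 2 * m - 1 - k := by
      rw [Fin.val_rev, Nat.cast_sub (by omega)]
      push_cast
      ring
    rw [Fin.revPerm_apply, Fin.rev_rev, h]
    ring
  rw [h, fderiv_connectionForm, formΩ_apply, ← Finset.sum_sub_distrib]
  exact Finset.sum_congr rfl fun k _ => by ring

/-- The form `connectionForm`, as an alternating form of degree one. -/
def connectionOneForm (n : ℕ) (a : V n) : V n [⋀^Fin 1]→L[ℝ] ℝ :=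
  ContinuousAlternatingMap.ofSubsingletonLIE (𝕜 := ℝ) (E := V n) (F := ℝ) (0 : Fin 1)
    (connectionForm n a)

theorem connectionOneForm_apply (a : V n) (v : Fin 1 → V n) :
    connectionOneForm n a v = connectionForm n a (v 0) := rfl

theorem contDiff_connectionOneForm : ContDiff ℝ ∞ (connectionOneForm n) :=
  (ContinuousAlternatingMap.ofSubsingletonLIE (𝕜 := ℝ) (E := V n) (F := ℝ) (0 : Fin 1)).contDiff.comp
    contDiff_connectionForm

theorem extDeriv_connectionOneForm (m : ℕ) : extDeriv (connectionOneForm (2 * m)) = formΩ m := by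
  funext a
  ext v
  have hd : DifferentiableAt ℝ (connectionForm (2 * m)) a :=
    contDiff_connectionForm.differentiable (by simp) a
  have h : ∀ u w : V (2 * m), fderiv ℝ (fun b => connectionForm (2 * m) b w) a u =
      fderiv ℝ (connectionForm (2 * m)) a u w := by
    intro u w
    rw [fderiv_clm_apply hd (differentiableAt_const w)]
    simp
  have hv : v = ![v 0, v 1] := by ext i; fin_cases i <;> rfl
  rw [extDeriv_apply (contDiff_connectionOneForm.differentiable (by simp) a), Fin.sum_univ_two]
  simp only [connectionOneForm_apply, h]
  rw [hv, formΩ_eq_fderiv]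
  simp [Fin.removeNth, sub_eq_add_neg]

theorem contDiff_formΩ (m : ℕ) : ContDiff ℝ ∞ (formΩ m) := by
  rw [← extDeriv_connectionOneForm]
  exact (ContinuousAlternatingMap.alternatizeUncurryFinCLM ℝ (V (2 * m)) ℝ).contDiff.comp
    (contDiff_connectionOneForm.fderiv_right (m := ∞) le_rfl)

theorem extDeriv_formΩ (m : ℕ) : extDeriv (formΩ m) = 0 := by
  rw [← extDeriv_connectionOneForm]
  exact extDeriv_extDeriv (contDiff_connectionOneForm (n := 2 * m)) (by
    rw [minSmoothness_of_isRCLikeNormedField]; exact ENat.LEInfty.out)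

end V

/-! ### The covering `V n → Nilmanifold n` -/

instance : ProperSpace (V n) := inferInstanceAs (ProperSpace (Fin n → ℝ))

instance discreteTopology_latticeΓ (n : ℕ) : DiscreteTopology (latticeΓ n) := by
  have hd : (n.factorial : ℝ) ≠ 0 := by exact_mod_cast n.factorial_ne_zero
  choose f hf using fun a : latticeΓ n => V.exists_int_of_mem_latticeΓ a.2
  refine DiscreteTopology.of_continuous_injective (f := f) ?_ fun a b hab => ?_
  · refine continuous_pi fun k => Int.isClosedEmbedding_coe_real.isInducing.continuous_iff.mpr ?_
    have : (Int.cast ∘ fun a => f a k : latticeΓ n → ℝ) =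
        fun a : latticeΓ n => (n.factorial : ℝ) ^ ((k : ℕ) + 1) * V.coord n a k :=
      funext fun a => (hf a k).symm
    rw [this]
    exact continuous_const.mul ((V.contDiff_coord k).continuous.comp continuous_subtype_val)
  · ext k
    have h := (hf a k).trans ((congrArg (fun g => ((g k : ℤ) : ℝ)) hab).trans (hf b k).symm)
    exact mul_left_cancel₀ (pow_ne_zero _ hd) h

theorem isDiscrete_latticeΓ (n : ℕ) : IsDiscrete (latticeΓ n : Set (V n)) :=
  isDiscrete_iff_discreteTopology.mpr (discreteTopology_latticeΓ n)

namespace Nilmanifold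

theorem proj_eq_proj_iff {a b : V n} : proj n a = proj n b ↔ b * a⁻¹ ∈ latticeΓ n :=
  Quotient.eq''.trans QuotientGroup.rightRel_apply

theorem proj_mul {γ : V n} (hγ : γ ∈ latticeΓ n) (a : V n) : proj n (γ * a) = proj n a :=
  (proj_eq_proj_iff.mpr (by rwa [mul_inv_cancel_right])).symm

theorem isQuotientCoveringMap_proj (n : ℕ) : IsQuotientCoveringMap (proj n) (latticeΓ n) :=
  isQuotientMap_quotient_mk'.isQuotientCoveringMap_of_subgroup (latticeΓ n)
    (isDiscrete_latticeΓ n) proj_eq_proj_iff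

theorem isCoveringMap_proj (n : ℕ) : IsCoveringMap (proj n) :=
  (isQuotientCoveringMap_proj n).isCoveringMap

theorem surjective_proj (n : ℕ) : Function.Surjective (proj n) := Quotient.mk_surjective

theorem continuous_proj (n : ℕ) : Continuous (proj n) := (isCoveringMap_proj n).continuous

instance t2Space (n : ℕ) : T2Space (Nilmanifold n) := by
  have h1 : ProperlyDiscontinuousSMul (latticeΓ n) (V n) :=
    (latticeΓ n).properlyDiscontinuousSMul_of_tendsto_cofinite
      ((latticeΓ n).tendsto_coe_cofinite_of_discrete (isDiscrete_latticeΓ n))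
  exact t2Space_of_properlyDiscontinuousSMul_of_t2Space (Γ := latticeΓ n) (T := V n)

instance compactSpace (n : ℕ) : CompactSpace (Nilmanifold n) := by
  have hK : IsCompact ((V.coord n).symm '' Set.pi Set.univ fun _ => Set.Icc (0 : ℝ) 1) :=
    (isCompact_univ_pi fun _ => isCompact_Icc).image (V.coord n).symm.continuous
  refine ⟨?_⟩
  convert hK.image (continuous_proj n)
  refine (Set.eq_univ_of_forall fun p => ?_).symm
  obtain ⟨a, rfl⟩ := surjective_proj n p
  obtain ⟨γ, hγ, h⟩ := V.exists_mul_mem_box a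
  exact ⟨γ * a, ⟨V.coord n (γ * a), fun k _ => h k, (V.coord n).symm_apply_apply _⟩, proj_mul hγ a⟩

/-- Two lifts of the same map with connected domain differ by an element of the lattice. -/
theorem exists_eq_mul_of_proj_eq {X : Type*} [TopologicalSpace X] {s : Set X}
    (hs : IsPreconnected s) {f g : X → V n} (hf : ContinuousOn f s) (hg : ContinuousOn g s)
    (h : ∀ x ∈ s, proj n (g x) = proj n (f x)) : ∃ γ ∈ latticeΓ n, ∀ x ∈ s, f x = γ * g x := by
  obtain ⟨γ, hγ, h'⟩ := hs.eqOn_const_of_mapsTo (isDiscrete_latticeΓ n)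
    (f := fun x => f x * (g x)⁻¹) (hf.mul hg.inv) (fun x hx => proj_eq_proj_iff.mp (h x hx))
    ⟨1, one_mem _⟩
  exact ⟨γ, hγ, fun x hx => mul_inv_eq_iff_eq_mul.mp (h' hx)⟩

/-! ### The smooth structure -/

theorem exists_openPartialHomeomorph (a : V n) :
    ∃ e : OpenPartialHomeomorph (V n) (Nilmanifold n), a ∈ e.source ∧ proj n = e :=
  (isCoveringMap_proj n).isLocalHomeomorph a

/-- The charts are all the local inverses of the projection. -/
instance chartedSpace (n : ℕ) : ChartedSpace (V n) (Nilmanifold n) where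
  atlas := {e | ∀ y ∈ e.target, e.symm y = proj n y}
  chartAt p := (exists_openPartialHomeomorph (surjective_proj n p).choose).choose.symm
  mem_chart_source p := by
    have h := (exists_openPartialHomeomorph (surjective_proj n p).choose).choose_spec
    have h' := OpenPartialHomeomorph.map_source _ h.1
    rwa [← h.2, (surjective_proj n p).choose_spec] at h'
  chart_mem_atlas p y _ := by
    have h := (exists_openPartialHomeomorph (surjective_proj n p).choose).choose_spec
    rw [OpenPartialHomeomorph.symm_symm, ← h.2]

theorem symm_eq_proj {e : OpenPartialHomeomorph (Nilmanifold n) (V n)}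
    (he : e ∈ atlas (V n) (Nilmanifold n)) {y : V n} (hy : y ∈ e.target) :
    e.symm y = proj n y := he y hy

theorem proj_chart {e : OpenPartialHomeomorph (Nilmanifold n) (V n)}
    (he : e ∈ atlas (V n) (Nilmanifold n)) {p : Nilmanifold n} (hp : p ∈ e.source) :
    proj n (e p) = p := by
  rw [← symm_eq_proj he (e.map_source hp), e.left_inv hp]

/-- In a chart, the projection is locally a left translation by an element of the lattice. -/
theorem eventuallyEq_mul {e : OpenPartialHomeomorph (Nilmanifold n) (V n)}
    (he : e ∈ atlas (V n) (Nilmanifold n)) {a : V n} (ha : proj n a ∈ e.source) :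
    ∃ γ ∈ latticeΓ n, (fun y => e (proj n y)) =ᶠ[𝓝 a] fun y => γ * y := by
  have hU : IsOpen (proj n ⁻¹' e.source) := e.open_source.preimage (continuous_proj n)
  obtain ⟨r, hr, hball⟩ := Metric.isOpen_iff.mp hU a ha
  obtain ⟨γ, hγ, h⟩ := exists_eq_mul_of_proj_eq (convex_ball a r).isPreconnected
    (f := fun y => e (proj n y)) (g := id)
    (e.continuousOn.comp (continuous_proj n).continuousOn hball) continuousOn_id
    fun x hx => (proj_chart he (hball hx)).symm
  exact ⟨γ, hγ, Filter.eventually_of_mem (Metric.ball_mem_nhds a hr) h⟩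

instance isManifold (n : ℕ) : IsManifold 𝓘(ℝ, V n) ∞ (Nilmanifold n) := by
  refine isManifold_of_contDiffOn _ _ _ fun e e' he he' => ?_
  simp only [modelWithCornersSelf_coe, modelWithCornersSelf_coe_symm, Function.id_comp,
    Function.comp_id, Set.preimage_id_eq, id, Set.range_id, Set.inter_univ]
  intro y hy
  rw [OpenPartialHomeomorph.trans_source, OpenPartialHomeomorph.symm_source] at hy
  have hy2 : proj n y ∈ e'.source := by rw [← symm_eq_proj he hy.1]; exact hy.2
  obtain ⟨γ, -, h⟩ := eventuallyEq_mul he' hy2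
  refine ContDiffAt.contDiffWithinAt
    (ContDiffAt.congr_of_eventuallyEq (V.contDiff_mul_left γ).contDiffAt ?_)
  filter_upwards [h, e.open_target.mem_nhds hy.1] with z hz hz'
  rw [← hz, ← symm_eq_proj he hz']
  rfl

theorem isLocalDiffeomorph_proj (n : ℕ) :
    IsLocalDiffeomorph 𝓘(ℝ, V n) 𝓘(ℝ, V n) ∞ (proj n) := by
  intro a
  obtain ⟨e, ha, he⟩ := exists_openPartialHomeomorph a
  have hmem : e.symm ∈ IsManifold.maximalAtlas 𝓘(ℝ, V n) ∞ (Nilmanifold n) := by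
    apply IsManifold.subset_maximalAtlas
    intro y _
    rw [OpenPartialHomeomorph.symm_symm, he]
  refine ⟨{ e.toPartialEquiv with
    open_source := e.open_source
    open_target := e.open_target
    contMDiffOn_toFun := contMDiffOn_symm_of_mem_maximalAtlas hmem
    contMDiffOn_invFun := contMDiffOn_of_mem_maximalAtlas hmem }, ha, fun y _ => ?_⟩
  rw [he]; rfl

theorem contMDiff_proj (n : ℕ) : ContMDiff 𝓘(ℝ, V n) 𝓘(ℝ, V n) ∞ (proj n) :=
  (isLocalDiffeomorph_proj n).contMDiff

/-- In the identification of the tangent space at `proj n a` with `V n` by the preferred chart, the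
differential of the projection at `a` is the linear part of the left translation by the lattice
element that moves `a` to the image of its class in the chart. -/
theorem mfderiv_proj (a : V n) : ∃ γ ∈ latticeΓ n,
    chartAt (V n) (proj n a) (proj n a) = γ * a ∧
      (mfderiv 𝓘(ℝ, V n) 𝓘(ℝ, V n) (proj n) a : V n →L[ℝ] V n) = V.leftMap γ := by
  obtain ⟨γ, hγ, h⟩ := eventuallyEq_mul (chart_mem_atlas (V n) (proj n a))
    (mem_chart_source (V n) (proj n a))
  refine ⟨γ, hγ, h.eq_of_nhds, ?_⟩
  refine (((contMDiff_proj n) a).mdifferentiableAt (by simp)).mfderiv.trans ?_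
  simp only [modelWithCornersSelf_coe, Set.range_id, fderivWithin_univ]
  have h' : writtenInExtChartAt 𝓘(ℝ, V n) 𝓘(ℝ, V n) a (proj n) =
      fun y => chartAt (V n) (proj n a) (proj n y) := rfl
  rw [h']
  exact ((V.hasFDerivAt_mul_left γ a).congr_of_eventuallyEq h).fderiv

end Nilmanifold

/-! ### The symplectic form -/

section Forms

variable {E : Type*} [NormedAddCommGroup E] [NormedSpace ℝ E]
  {M : Type*} [TopologicalSpace M] [ChartedSpace E M]
  {F : Type*} [NormedAddCommGroup F] [NormedSpace ℝ F]

theorem pullbackForm_congr {f g : F → M} {y : F} (h : f =ᶠ[𝓝 y] g) (η : TwoForm E M) :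
    pullbackForm f η y = pullbackForm g η y := by
  have h1 : (mfderiv 𝓘(ℝ, F) 𝓘(ℝ, E) f y : F →L[ℝ] E) = mfderiv 𝓘(ℝ, F) 𝓘(ℝ, E) g y :=
    h.mfderiv_eq
  -- As a function of a point and of a linear map between fixed spaces, the pulled back covector can
  -- be rewritten in both arguments, in spite of the dependent type of the tangent map.
  let Ψ : M → (F →L[ℝ] E) → F [⋀^Fin 2]→L[ℝ] ℝ := fun p L =>
    ContinuousAlternatingMap.compContinuousLinearMap (show E [⋀^Fin 2]→L[ℝ] ℝ from η p) L
  change Ψ (f y) (mfderiv 𝓘(ℝ, F) 𝓘(ℝ, E) f y) = Ψ (g y) (mfderiv 𝓘(ℝ, F) 𝓘(ℝ, E) g y)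
  rw [h1, h.eq_of_nhds]

theorem pullbackForm_smul (c : ℝ) (f : F → M) (η : TwoForm E M) :
    pullbackForm f (c • η) = c • pullbackForm f η := rfl

theorem IsSymplecticForm.smul {η : TwoForm E M} (h : IsSymplecticForm η) {c : ℝ} (hc : c ≠ 0) :
    IsSymplecticForm (c • η) where
  smooth e he := by
    rw [pullbackForm_smul]
    exact (h.smooth e he).const_smul c
  closed e he y hy := by
    rw [pullbackForm_smul, extDeriv_smul, h.closed e he y hy, smul_zero]
  nondegenerate p v hv := h.nondegenerate p v fun w => by
    have := hv w
    exact (mul_eq_zero.mp this).resolve_left hc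

end Forms

namespace Nilmanifold

/-- The 2-form on the quotient induced by the left-invariant form `formΩ`. The tangent space at `p`
is identified with the model space through the preferred chart at `p`, which is a local inverse of
the projection, so the induced form at `p` is `formΩ` at the image of `p` in the chart. -/
def inducedForm (m : ℕ) : TwoForm (V (2 * m)) (Nilmanifold (2 * m)) :=
  fun p => formΩ m (chartAt (V (2 * m)) p p)

theorem inducedForm_mfderiv_proj (m : ℕ) (a v w : V (2 * m)) :
    inducedForm m (proj (2 * m) a)
      ![mfderiv 𝓘(ℝ, V (2 * m)) 𝓘(ℝ, V (2 * m)) (proj (2 * m)) a v,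
        mfderiv 𝓘(ℝ, V (2 * m)) 𝓘(ℝ, V (2 * m)) (proj (2 * m)) a w] = formΩ m a ![v, w] := by
  obtain ⟨γ, -, h1, h2⟩ := mfderiv_proj a
  change formΩ m (chartAt (V (2 * m)) (proj (2 * m) a) (proj (2 * m) a))
    ![(mfderiv 𝓘(ℝ, V (2 * m)) 𝓘(ℝ, V (2 * m)) (proj (2 * m)) a : V (2 * m) →L[ℝ] V (2 * m)) v,
      (mfderiv 𝓘(ℝ, V (2 * m)) 𝓘(ℝ, V (2 * m)) (proj (2 * m)) a : V (2 * m) →L[ℝ] V (2 * m)) w] = _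
  rw [h1, h2]
  exact V.formΩ_mul m γ a v w

theorem pullbackForm_proj (m : ℕ) :
    pullbackForm (proj (2 * m)) (inducedForm m) = formΩ m := by
  funext a
  ext v
  have hv : v = ![v 0, v 1] := by ext i; fin_cases i <;> rfl
  conv_rhs => rw [hv, ← inducedForm_mfderiv_proj]
  rw [hv]
  change inducedForm m (proj (2 * m) a) _ = _
  congr 1
  funext i
  fin_cases i <;> rfl

theorem isSymplecticForm_inducedForm (m : ℕ) : IsSymplecticForm (inducedForm m) := by
  have h : ∀ e ∈ atlas (V (2 * m)) (Nilmanifold (2 * m)), ∀ y ∈ e.target,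
      pullbackForm e.symm (inducedForm m) y = formΩ m y := by
    intro e he y hy
    rw [← pullbackForm_proj]
    refine pullbackForm_congr ?_ _
    filter_upwards [e.open_target.mem_nhds hy] with z hz using symm_eq_proj he hz
  refine ⟨fun e he => (V.contDiff_formΩ m).contDiffOn.congr (h e he), fun e he y hy => ?_,
    fun p v hv => V.formΩ_nondegenerate m _ v hv⟩
  have h' : pullbackForm e.symm (inducedForm m) =ᶠ[𝓝 y] formΩ m :=
    Filter.eventually_of_mem (e.open_target.mem_nhds hy) (h e he)
  rw [h'.extDeriv_eq, V.extDeriv_formΩ]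
  rfl

end Nilmanifold

open MeasureTheory Set

/-! ### Stokes' theorem on the triangle -/

theorem isClosed_stdTriangle : IsClosed stdTriangle := by
  have h : stdTriangle = {p : ℝ × ℝ | 0 ≤ p.1} ∩ ({p | 0 ≤ p.2} ∩ {p | p.1 + p.2 ≤ 1}) := rfl
  rw [h]
  exact (isClosed_le continuous_const continuous_fst).inter
    ((isClosed_le continuous_const continuous_snd).inter
      (isClosed_le (continuous_fst.add continuous_snd) continuous_const))

theorem isCompact_stdTriangle : IsCompact stdTriangle := by
  refine (isCompact_Icc (a := ((0 : ℝ), (0 : ℝ))) (b := (1, 1))).of_isClosed_subset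
    isClosed_stdTriangle ?_
  rintro ⟨x, y⟩ ⟨h1, h2, h3⟩
  simp only at h1 h2 h3
  exact ⟨⟨h1, h2⟩, ⟨by simp only; linarith, by simp only; linarith⟩⟩

theorem convex_stdTriangle : Convex ℝ stdTriangle := by
  rintro ⟨x, y⟩ ⟨h1, h2, h3⟩ ⟨x', y'⟩ ⟨h1', h2', h3'⟩ a b ha hb hab
  simp only at h1 h2 h3 h1' h2' h3'
  refine ⟨by simp; positivity, by simp; positivity, ?_⟩
  simp only [Prod.smul_mk, smul_eq_mul, Prod.mk_add_mk]
  nlinarith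

theorem nonempty_interior_stdTriangle : (interior stdTriangle).Nonempty := by
  refine ⟨(1 / 4, 1 / 4), mem_interior.mpr
    ⟨{p : ℝ × ℝ | 0 < p.1} ∩ ({p | 0 < p.2} ∩ {p | p.1 + p.2 < 1}), ?_, ?_, ?_⟩⟩
  · rintro p ⟨h1, h2, h3⟩
    exact ⟨le_of_lt h1, le_of_lt h2, le_of_lt h3⟩
  · exact (isOpen_lt continuous_const continuous_fst).inter
      ((isOpen_lt continuous_const continuous_snd).inter
        (isOpen_lt (continuous_fst.add continuous_snd) continuous_const))
  · norm_num

theorem uniqueDiffOn_stdTriangle : UniqueDiffOn ℝ stdTriangle :=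
  uniqueDiffOn_convex convex_stdTriangle nonempty_interior_stdTriangle

theorem mem_closure_interior_stdTriangle {p : ℝ × ℝ} (hp : p ∈ stdTriangle) :
    p ∈ closure (interior stdTriangle) := by
  rw [convex_stdTriangle.closure_interior_eq_closure_of_nonempty_interior
    nonempty_interior_stdTriangle]
  exact subset_closure hp

/-- Fubini's theorem for the triangle. -/
theorem setIntegral_stdTriangle {g : ℝ × ℝ → ℝ} (hg : ContinuousOn g stdTriangle) :
    ∫ p in stdTriangle, g p = ∫ y in (0 : ℝ)..1, ∫ x in (0 : ℝ)..(1 - y), g (x, y) := by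
  have hint : Integrable (stdTriangle.indicator g) :=
    (integrable_indicator_iff isClosed_stdTriangle.measurableSet).mpr
      (hg.integrableOn_compact isCompact_stdTriangle)
  have h : ∀ y : ℝ, ∫ x, stdTriangle.indicator g (x, y) =
      (Icc (0 : ℝ) 1).indicator (fun y => ∫ x in (0 : ℝ)..(1 - y), g (x, y)) y := by
    intro y
    by_cases hy : y ∈ Icc (0 : ℝ) 1
    · rw [indicator_of_mem hy, intervalIntegral.integral_of_le (by linarith [hy.2]),
        ← integral_Icc_eq_integral_Ioc, ← integral_indicator measurableSet_Icc]
      congr 1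
      funext x
      have : (x, y) ∈ stdTriangle ↔ x ∈ Icc 0 (1 - y) :=
        ⟨fun h => ⟨h.1, by linarith [h.2.2]⟩, fun h => ⟨h.1, hy.1, by linarith [h.2]⟩⟩
      by_cases hx : x ∈ Icc 0 (1 - y)
      · rw [indicator_of_mem hx, indicator_of_mem (this.mpr hx)]
      · rw [indicator_of_notMem hx, indicator_of_notMem (mt this.mp hx)]
    · rw [indicator_of_notMem hy]
      have : ∀ x, stdTriangle.indicator g (x, y) = 0 := fun x =>
        indicator_of_notMem (fun h => hy ⟨h.2.1, by linarith [h.1, h.2.2]⟩) _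
      simp [this]
  rw [← integral_indicator isClosed_stdTriangle.measurableSet, Measure.volume_eq_prod,
    integral_prod_symm _ hint]
  simp only [h]
  rw [integral_indicator measurableSet_Icc, integral_Icc_eq_integral_Ioc,
    ← intervalIntegral.integral_of_le zero_le_one]

theorem continuousOn_fderivWithin_stdTriangle {f : ℝ × ℝ → ℝ} (hf : ContDiffOn ℝ 1 f stdTriangle)
    (u : ℝ × ℝ) : ContinuousOn (fun p => fderivWithin ℝ f stdTriangle p u) stdTriangle :=
  (hf.continuousOn_fderivWithin uniqueDiffOn_stdTriangle le_rfl).clm_apply continuousOn_const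

theorem setIntegral_stdTriangle_fderivWithin_fst {f : ℝ × ℝ → ℝ}
    (hf : ContDiffOn ℝ 1 f stdTriangle) :
    ∫ p in stdTriangle, fderivWithin ℝ f stdTriangle p (1, 0) =
      ∫ y in (0 : ℝ)..1, (f (1 - y, y) - f (0, y)) := by
  have hc := continuousOn_fderivWithin_stdTriangle hf (1, 0)
  rw [setIntegral_stdTriangle hc]
  refine intervalIntegral.integral_congr fun y hy => ?_
  rw [uIcc_of_le zero_le_one] at hy
  have hmaps : MapsTo (fun x : ℝ => (x, y)) (Icc 0 (1 - y)) stdTriangle :=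
    fun x hx => ⟨hx.1, hy.1, by linarith [hx.2]⟩
  have hcont : ContinuousOn (fun x : ℝ => (x, y)) (Icc 0 (1 - y)) := by fun_prop
  have hle : (0 : ℝ) ≤ 1 - y := by linarith [hy.2]
  refine intervalIntegral.integral_eq_sub_of_hasDerivAt_of_le (f := fun x => f (x, y)) hle
    (hf.continuousOn.comp hcont hmaps) (fun x hx => ?_)
    (ContinuousOn.intervalIntegrable ?_)
  · have h1 : HasFDerivWithinAt f (fderivWithin ℝ f stdTriangle (x, y)) stdTriangle (x, y) :=
      (hf.differentiableOn one_ne_zero _ (hmaps (Ioo_subset_Icc_self hx))).hasFDerivWithinAt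
    have h2 : HasDerivAt (fun x : ℝ => (x, y)) (1, 0) x :=
      (hasDerivAt_id x).prodMk (hasDerivAt_const x y)
    exact (h1.comp_hasDerivWithinAt x h2.hasDerivWithinAt hmaps).hasDerivAt
      (Icc_mem_nhds hx.1 hx.2)
  · rw [uIcc_of_le hle]
    exact hc.comp hcont hmaps

theorem setIntegral_stdTriangle_fderivWithin_snd {f : ℝ × ℝ → ℝ}
    (hf : ContDiffOn ℝ 1 f stdTriangle) :
    ∫ p in stdTriangle, fderivWithin ℝ f stdTriangle p (0, 1) =
      ∫ x in (0 : ℝ)..1, (f (x, 1 - x) - f (x, 0)) := by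
  have hswap : ∀ p : ℝ × ℝ, p.swap ∈ stdTriangle ↔ p ∈ stdTriangle := fun p =>
    ⟨fun h => ⟨h.2.1, h.1, (add_comm _ _).trans_le h.2.2⟩,
      fun h => ⟨h.2.1, h.1, (add_comm _ _).trans_le h.2.2⟩⟩
  have hmaps : MapsTo Prod.swap stdTriangle stdTriangle := fun p hp => (hswap p).mpr hp
  have hsd : ContDiff ℝ 1 (Prod.swap : ℝ × ℝ → ℝ × ℝ) := contDiff_snd.prodMk contDiff_fst
  have hf' : ContDiffOn ℝ 1 (f ∘ Prod.swap) stdTriangle := hf.comp hsd.contDiffOn hmaps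
  have h := setIntegral_stdTriangle_fderivWithin_fst hf'
  simp only [Function.comp_apply, Prod.swap_prod_mk] at h
  have hmp : MeasurePreserving (Prod.swap : ℝ × ℝ → ℝ × ℝ) volume volume :=
    Measure.measurePreserving_swap
  rw [← h, ← hmp.setIntegral_preimage_emb MeasurableEquiv.prodComm.measurableEmbedding]
  have hpre : Prod.swap ⁻¹' stdTriangle = stdTriangle := Set.ext hswap
  rw [hpre]
  refine setIntegral_congr_fun isClosed_stdTriangle.measurableSet fun p hp => ?_
  have h1 : HasFDerivWithinAt f (fderivWithin ℝ f stdTriangle p.swap) stdTriangle p.swap :=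
    (hf.differentiableOn one_ne_zero _ (hmaps hp)).hasFDerivWithinAt
  have h2 : HasFDerivWithinAt (Prod.swap : ℝ × ℝ → ℝ × ℝ)
      ((ContinuousLinearMap.snd ℝ ℝ ℝ).prod (ContinuousLinearMap.fst ℝ ℝ ℝ)) stdTriangle p :=
    ((ContinuousLinearMap.snd ℝ ℝ ℝ).prod (ContinuousLinearMap.fst ℝ ℝ ℝ)).hasFDerivWithinAt
  have h3 := (h1.comp p h2 hmaps).fderivWithin (uniqueDiffOn_stdTriangle p hp)
  simp only [h3]
  simp

section Stokes

variable {E : Type*} [NormedAddCommGroup E] [NormedSpace ℝ E]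

/-- The integral of a 1-form along the restriction of a path to `[0, 1]`. The derivative is taken
within `[0, 1]`, so the values of `c` elsewhere do not matter. -/
def lineIntegral (θ : E → E →L[ℝ] ℝ) (c : ℝ → E) : ℝ :=
  ∫ t in (0 : ℝ)..1, θ (c t) (derivWithin c (Icc 0 1) t)

theorem derivWithin_comp_stdTriangle {s : ℝ × ℝ → E} (hs : ContDiffOn ℝ ∞ s stdTriangle)
    {e : ℝ → ℝ × ℝ} {u : ℝ × ℝ} (he : ∀ t, HasDerivAt e u t)
    (hmaps : MapsTo e (Icc 0 1) stdTriangle) {t : ℝ} (ht : t ∈ Icc (0 : ℝ) 1) :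
    derivWithin (fun t => s (e t)) (Icc 0 1) t = fderivWithin ℝ s stdTriangle (e t) u := by
  have h1 : HasFDerivWithinAt s (fderivWithin ℝ s stdTriangle (e t)) stdTriangle (e t) :=
    (hs.differentiableOn (by simp) _ (hmaps ht)).hasFDerivWithinAt
  exact (h1.comp_hasDerivWithinAt t (he t).hasDerivWithinAt hmaps).derivWithin
    (uniqueDiffOn_Icc zero_lt_one t ht)

/-- Stokes' theorem for a smooth triangle in a normed space. -/
theorem setIntegral_stdTriangle_eq_lineIntegral {θ : E → E →L[ℝ] ℝ} (hθ : ContDiff ℝ ∞ θ)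
    {s : ℝ × ℝ → E} (hs : ContDiffOn ℝ ∞ s stdTriangle) :
    ∫ p in stdTriangle,
        (fderiv ℝ θ (s p) (fderivWithin ℝ s stdTriangle p (1, 0))
            (fderivWithin ℝ s stdTriangle p (0, 1))
          - fderiv ℝ θ (s p) (fderivWithin ℝ s stdTriangle p (0, 1))
            (fderivWithin ℝ s stdTriangle p (1, 0))) =
      lineIntegral θ (fun t => s (1 - t, t)) - lineIntegral θ (fun t => s (0, t))
        + lineIntegral θ (fun t => s (t, 0)) := by
  let T := stdTriangle
  let f : ℝ × ℝ → ℝ × ℝ → ℝ := fun u p => θ (s p) (fderivWithin ℝ s T p u)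
  have hds : ContDiffOn ℝ ∞ (fderivWithin ℝ s T) T :=
    hs.fderivWithin uniqueDiffOn_stdTriangle le_rfl
  have hf : ∀ u, ContDiffOn ℝ 1 (f u) T := fun u =>
    ((hθ.comp_contDiffOn hs).clm_apply (hds.clm_apply contDiffOn_const)).of_le
      (by exact_mod_cast le_top)
  have hfd : ∀ u w, ∀ p ∈ T, fderivWithin ℝ (f u) T p w =
      fderiv ℝ θ (s p) (fderivWithin ℝ s T p w) (fderivWithin ℝ s T p u)
        + θ (s p) (fderivWithin ℝ (fderivWithin ℝ s T) T p w u) := by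
    intro u w p hp
    have h1 : HasFDerivWithinAt s (fderivWithin ℝ s T p) T p :=
      (hs.differentiableOn (by simp) p hp).hasFDerivWithinAt
    have h2 : HasFDerivWithinAt (fderivWithin ℝ s T)
        (fderivWithin ℝ (fderivWithin ℝ s T) T p) T p :=
      (hds.differentiableOn (by simp) p hp).hasFDerivWithinAt
    have h3 := ((hθ.differentiable (by simp) (s p)).hasFDerivAt).comp_hasFDerivWithinAt p h1
    have h4 := h3.clm_apply (h2.clm_apply (hasFDerivWithinAt_const u p T))
    have h5 := h4.fderivWithin (uniqueDiffOn_stdTriangle p hp)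
    change fderivWithin ℝ (fun p => (θ ∘ s) p (fderivWithin ℝ s T p u)) T p w = _
    rw [h5]
    simp [add_comm]
  have hsymm : ∀ p ∈ T, fderivWithin ℝ (fderivWithin ℝ s T) T p (1, 0) (0, 1) =
      fderivWithin ℝ (fderivWithin ℝ s T) T p (0, 1) (1, 0) := fun p hp =>
    ((hs p hp).isSymmSndFDerivWithinAt
      (by rw [minSmoothness_of_isRCLikeNormedField]; exact ENat.LEInfty.out)
      uniqueDiffOn_stdTriangle (mem_closure_interior_stdTriangle hp) hp) _ _
  have hint : ∀ u w, IntegrableOn (fun p => fderivWithin ℝ (f u) T p w) T := fun u w =>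
    (continuousOn_fderivWithin_stdTriangle (hf u) w).integrableOn_compact isCompact_stdTriangle
  have hm1 : MapsTo (fun t : ℝ => (1 - t, t)) (Icc 0 1) T :=
    fun t ht => ⟨by linarith [ht.2], ht.1, by simp⟩
  have hm2 : MapsTo (fun t : ℝ => ((0 : ℝ), t)) (Icc 0 1) T :=
    fun t ht => ⟨le_rfl, ht.1, by simpa using ht.2⟩
  have hm3 : MapsTo (fun t : ℝ => (t, (0 : ℝ))) (Icc 0 1) T :=
    fun t ht => ⟨ht.1, le_rfl, by simpa using ht.2⟩
  have hi : ∀ u, ∀ e : ℝ → ℝ × ℝ, Continuous e → MapsTo e (Icc 0 1) T →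
      IntervalIntegrable (fun t => f u (e t)) volume 0 1 := by
    intro u e he hm
    refine ContinuousOn.intervalIntegrable ?_
    rw [uIcc_of_le zero_le_one]
    exact (hf u).continuousOn.comp he.continuousOn hm
  have hi1 := fun u => hi u _ (by fun_prop) hm1
  have hi2 := fun u => hi u _ (by fun_prop) hm2
  have hi3 := fun u => hi u _ (by fun_prop) hm3
  have e1 : lineIntegral θ (fun t => s (1 - t, t)) =
      ∫ t in (0 : ℝ)..1, (f (0, 1) (1 - t, t) - f (1, 0) (1 - t, t)) := by
    refine intervalIntegral.integral_congr fun t ht => ?_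
    rw [uIcc_of_le zero_le_one] at ht
    have hd : ∀ t : ℝ, HasDerivAt (fun t : ℝ => (1 - t, t)) (-1, 1) t := fun t =>
      ((hasDerivAt_id t).const_sub 1).prodMk (hasDerivAt_id t)
    have hu : ((-1, 1) : ℝ × ℝ) = (0, 1) - (1, 0) := by simp
    simp only [f]
    rw [derivWithin_comp_stdTriangle hs hd hm1 ht, hu, map_sub, map_sub]
  have e2 : lineIntegral θ (fun t => s (0, t)) = ∫ t in (0 : ℝ)..1, f (0, 1) (0, t) := by
    refine intervalIntegral.integral_congr fun t ht => ?_
    rw [uIcc_of_le zero_le_one] at ht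
    have hd : ∀ t : ℝ, HasDerivAt (fun t : ℝ => ((0 : ℝ), t)) (0, 1) t := fun t =>
      (hasDerivAt_const t _).prodMk (hasDerivAt_id t)
    simp only [f]
    rw [derivWithin_comp_stdTriangle hs hd hm2 ht]
  have e3 : lineIntegral θ (fun t => s (t, 0)) = ∫ t in (0 : ℝ)..1, f (1, 0) (t, 0) := by
    refine intervalIntegral.integral_congr fun t ht => ?_
    rw [uIcc_of_le zero_le_one] at ht
    have hd : ∀ t : ℝ, HasDerivAt (fun t : ℝ => (t, (0 : ℝ))) (1, 0) t := fun t =>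
      (hasDerivAt_id t).prodMk (hasDerivAt_const t _)
    simp only [f]
    rw [derivWithin_comp_stdTriangle hs hd hm3 ht]
  have hP : ∫ x in (0 : ℝ)..1, f (1, 0) (x, 1 - x) = ∫ t in (0 : ℝ)..1, f (1, 0) (1 - t, t) := by
    have := intervalIntegral.integral_comp_sub_left (fun x => f (1, 0) (x, 1 - x)) (1 : ℝ)
      (a := 0) (b := 1)
    simpa using this.symm
  have hi1' : IntervalIntegrable (fun x => f (1, 0) (x, 1 - x)) volume 0 1 :=
    hi (1, 0) (fun x => (x, 1 - x)) (by fun_prop)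
      fun t ht => ⟨ht.1, by linarith [ht.2], by simp⟩
  calc _ = ∫ p in T, (fderivWithin ℝ (f (0, 1)) T p (1, 0)
        - fderivWithin ℝ (f (1, 0)) T p (0, 1)) := by
        refine setIntegral_congr_fun isClosed_stdTriangle.measurableSet fun p hp => ?_
        rw [hfd _ _ p hp, hfd _ _ p hp, hsymm p hp]
        ring
    _ = _ := by
        rw [integral_sub (hint _ _) (hint _ _), setIntegral_stdTriangle_fderivWithin_fst (hf _),
          setIntegral_stdTriangle_fderivWithin_snd (hf _), e1, e2, e3,
          intervalIntegral.integral_sub (hi1 _) (hi2 _),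
          intervalIntegral.integral_sub hi1' (hi3 _),
          intervalIntegral.integral_sub (hi1 _) (hi1 _), hP]
        ring

end Stokes

/-! ### Holonomy of the circle bundle -/

namespace V

/-- The connection form changes under a left translation by the differential of the last
coordinate of the translated point. -/
theorem connectionForm_mul (g : V (n + 1)) (a v : V n) :
    connectionForm n (truncate n g * a) (leftMap (truncate n g) v) =
      connectionForm n a v + lastCoord n (leftMap g (extend n v)) := by
  have hpt : g * extend n a =
      extend n (truncate n g * a) * central n (lastCoord n (g * extend n a)) := by
    conv_lhs => rw [eq_extend_add_central (g * extend n a), truncate_mul, truncate_extend]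
    rw [mul_central]
  have hvec : leftMap g (extend n v) = extend n (leftMap (truncate n g) v) +
      central n (lastCoord n (leftMap g (extend n v))) := by
    conv_lhs => rw [eq_extend_add_central (leftMap g (extend n v)), truncate_leftMap,
      truncate_extend]
  have hc : ∀ (b : V (n + 1)) (z : ℝ), maurerCartan (b * central n z) = maurerCartan b := by
    intro b z
    have h : leftMap (central n z)⁻¹ = ContinuousLinearMap.id ℝ (V (n + 1)) := by
      ext1 w
      have := leftMap_inv_leftMap (central n z) w
      rwa [leftMap_central z] at this
    rw [maurerCartan, mul_inv_rev, leftMap_mul, h]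
    rfl
  have h := maurerCartan_mul g (extend n a) (extend n v)
  rw [hvec, hpt, hc, map_add] at h
  have h' : maurerCartan (extend n (truncate n g * a))
      (central n (lastCoord n (leftMap g (extend n v)))) = central n _ :=
    leftMap_apply_central _ _
  rw [h'] at h
  rw [connectionForm_apply, connectionForm_apply, ← h, map_add, lastCoord_central]
  ring

/-- A left translation by the image of `g` changes the integral of the connection form along a path
by the increment of the last coordinate of `g * extend n a` along the path. -/
theorem lineIntegral_mul (g : V (n + 1)) {c : ℝ → V n} (hc : ContDiffOn ℝ 1 c (Icc 0 1)) :
    lineIntegral (connectionForm n) (fun t => truncate n g * c t) =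
      lineIntegral (connectionForm n) c +
        (lastCoord n (g * extend n (c 1)) - lastCoord n (g * extend n (c 0))) := by
  let L : V n →L[ℝ] ℝ := (lastCoord n).comp ((leftMap g).comp (extend n))
  have hd : ∀ t ∈ Icc (0 : ℝ) 1, HasDerivWithinAt c (derivWithin c (Icc 0 1) t) (Icc 0 1) t :=
    fun t ht => (hc.differentiableOn one_ne_zero t ht).hasDerivWithinAt
  have hu := uniqueDiffOn_Icc (zero_lt_one (α := ℝ))
  have h1 : ∀ t ∈ Icc (0 : ℝ) 1, derivWithin (fun t => truncate n g * c t) (Icc 0 1) t =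
      leftMap (truncate n g) (derivWithin c (Icc 0 1) t) := fun t ht =>
    ((hasFDerivAt_mul_left (truncate n g) (c t)).comp_hasDerivWithinAt t (hd t ht)).derivWithin
      (hu t ht)
  have h2 : ∀ t ∈ Icc (0 : ℝ) 1, derivWithin (fun t => L (c t)) (Icc 0 1) t =
      L (derivWithin c (Icc 0 1) t) := fun t ht =>
    (L.hasFDerivAt.comp_hasDerivWithinAt t (hd t ht)).derivWithin (hu t ht)
  have hLc : ContDiffOn ℝ 1 (fun t => L (c t)) (Icc 0 1) := L.contDiff.comp_contDiffOn hc
  have h3 := intervalIntegral.integral_derivWithin_Icc_of_contDiffOn_Icc hLc zero_le_one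
  have hdc : ContinuousOn (derivWithin c (Icc 0 1)) (Icc 0 1) :=
    hc.continuousOn_derivWithin hu le_rfl
  have hi1 : IntervalIntegrable
      (fun t => connectionForm n (c t) (derivWithin c (Icc 0 1) t)) volume 0 1 := by
    refine ContinuousOn.intervalIntegrable ?_
    rw [uIcc_of_le zero_le_one]
    exact (contDiff_connectionForm.continuous.comp_continuousOn hc.continuousOn).clm_apply hdc
  have hi2 : IntervalIntegrable (fun t => derivWithin (fun t => L (c t)) (Icc 0 1) t)
      volume 0 1 := by
    refine ContinuousOn.intervalIntegrable ?_
    rw [uIcc_of_le zero_le_one]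
    exact hLc.continuousOn_derivWithin hu le_rfl
  have h4 : ∀ a : V n, lastCoord n (g * extend n a) = lastCoord n g + L a := fun a => by
    rw [mul_eq_add_leftMap, map_add]; rfl
  rw [h4, h4, add_sub_add_left_eq_sub, ← h3, lineIntegral, lineIntegral,
    ← intervalIntegral.integral_add hi1 hi2]
  refine intervalIntegral.integral_congr fun t ht => ?_
  rw [uIcc_of_le zero_le_one] at ht
  simp only [h1 t ht, h2 t ht, connectionForm_mul]
  rfl

/-- A common denominator for the last coordinates of the elements of the lattice in `V (n + 1)`. -/
def denominator (n : ℕ) : ℕ := (n + 1).factorial ^ (n + 1)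

theorem denominator_pos (n : ℕ) : 0 < denominator n := pow_pos (Nat.factorial_pos _) _

/-- The group `ℝ / (1 / N) ℤ` in which the holonomy takes its values, with `N` the common
denominator `denominator n`. -/
abbrev HolonomyGroup (n : ℕ) : Type := AddCircle ((denominator n : ℝ)⁻¹)

theorem coe_lastCoord_eq_zero {κ : V (n + 1)} (hκ : κ ∈ latticeΓ (n + 1)) :
    ((lastCoord n κ : ℝ) : HolonomyGroup n) = 0 := by
  have hN : (denominator n : ℝ) ≠ 0 := by exact_mod_cast (denominator_pos n).ne'
  obtain ⟨z, hz⟩ := exists_int_of_mem_latticeΓ hκ (Fin.last n)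
  refine (AddCircle.coe_eq_zero_iff _).mpr ⟨z, ?_⟩
  have hz' : (denominator n : ℝ) * lastCoord n κ = z := by
    rw [denominator, Nat.cast_pow]; exact hz
  rw [zsmul_eq_mul, ← hz', mul_comm, inv_mul_cancel_left₀ hN]

end V

namespace Nilmanifold

open V

theorem exists_truncate_eq {a : V n} (ha : a ∈ latticeΓ n) :
    ∃ γ ∈ latticeΓ (n + 1), truncate n γ = a := by
  rwa [← map_latticeΓ] at ha

theorem exists_lift_to_representative (a : V n) : ∃ γ ∈ latticeΓ (n + 1),
    truncate n γ * (proj n a).out = a := by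
  have h : proj n ((proj n a).out) = proj n a := Quotient.out_eq _
  obtain ⟨γ, hγ, h'⟩ := exists_truncate_eq (proj_eq_proj_iff.mp h)
  exact ⟨γ, hγ, by rw [h', inv_mul_cancel_right]⟩

/-- A (discontinuous) section of the circle bundle, in coordinates. The chosen representative of the
class of `a`, extended by the last coordinate zero, is moved by an element of the lattice in
`V (n + 1)` to a point over `a`; `fibreCoord a` is the last coordinate of that point, which modulo
`1 / N` does not depend on the lattice element by `fibreCoord_eq`. -/
def fibreCoord (a : V n) : HolonomyGroup n :=
  ((lastCoord n ((exists_lift_to_representative a).choose * extend n (proj n a).out) : ℝ) :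
    HolonomyGroup n)

theorem fibreCoord_eq {a : V n} {γ : V (n + 1)} (hγ : γ ∈ latticeΓ (n + 1))
    (h : truncate n γ * (proj n a).out = a) :
    fibreCoord a = ((lastCoord n (γ * extend n (proj n a).out) : ℝ) : HolonomyGroup n) := by
  obtain ⟨hδ, hδ'⟩ := (exists_lift_to_representative a).choose_spec
  rw [fibreCoord]
  set δ := (exists_lift_to_representative a).choose
  set o := (proj n a).out
  have h1 : truncate n (γ⁻¹ * δ) = 1 := by
    rw [truncate_mul, truncate_inv, inv_mul_eq_one]
    exact mul_right_cancel (h.trans hδ'.symm)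
  have h2 : δ * extend n o =
      γ * extend n o + central n (lastCoord n (γ⁻¹ * δ)) := by
    rw [← mul_central, mul_assoc, mul_central, ← central_mul, ← eq_central_of_truncate_eq_one h1,
      mul_assoc, mul_inv_cancel_left]
  rw [h2, map_add, lastCoord_central, AddCircle.coe_add,
    coe_lastCoord_eq_zero (mul_mem (inv_mem hγ) hδ), add_zero]

theorem fibreCoord_mul {g : V (n + 1)} (hg : g ∈ latticeΓ (n + 1)) (a : V n) :
    fibreCoord (truncate n g * a) =
      ((lastCoord n (g * extend n a) : ℝ) : HolonomyGroup n) + fibreCoord a := by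
  obtain ⟨γ, hγ, h⟩ := exists_lift_to_representative a
  have hg' : truncate n g ∈ latticeΓ n := by
    rw [← map_latticeΓ]; exact Subgroup.mem_map_of_mem _ hg
  have hproj : proj n (truncate n g * a) = proj n a := proj_mul hg' a
  have h1 : truncate n (g * γ) * (proj n (truncate n g * a)).out = truncate n g * a := by
    rw [hproj, truncate_mul, mul_assoc, h]
  have h2 : γ * extend n (proj n a).out =
      extend n a + central n (lastCoord n (γ * extend n (proj n a).out)) := by
    conv_lhs => rw [eq_extend_add_central (γ * extend n (proj n a).out), truncate_mul,
      truncate_extend, h]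
  rw [fibreCoord_eq (mul_mem hg hγ) h1, fibreCoord_eq hγ h, hproj, mul_assoc]
  rw [← AddCircle.coe_add]
  congr 1
  conv_lhs => rw [h2, ← mul_central, ← mul_assoc, mul_central, map_add, lastCoord_central]

/-- A continuously differentiable lift to `V n` of a path in the quotient. -/
def IsLift (τ : unitInterval → Nilmanifold n) (c : ℝ → V n) : Prop :=
  ContDiffOn ℝ 1 c (Icc 0 1) ∧ ∀ t : unitInterval, proj n (c t) = τ t

/-- The parallel transport along the image in the quotient of a path in `V n`, relative to the
fibre coordinates of its end points. -/
def transport (c : ℝ → V n) : HolonomyGroup n :=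
  ((lineIntegral (connectionForm n) c : ℝ) : HolonomyGroup n) - fibreCoord (c 1) + fibreCoord (c 0)

theorem transport_eq_of_isLift {τ : unitInterval → Nilmanifold n} {c c' : ℝ → V n}
    (hc : IsLift τ c) (hc' : IsLift τ c') : transport c' = transport c := by
  obtain ⟨γ, hγ, h⟩ := exists_eq_mul_of_proj_eq isPreconnected_Icc hc'.1.continuousOn
    hc.1.continuousOn fun t ht => (hc.2 ⟨t, ht⟩).trans (hc'.2 ⟨t, ht⟩).symm
  obtain ⟨g, hg, rfl⟩ := exists_truncate_eq hγ
  have h1 : lineIntegral (connectionForm n) c' =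
      lineIntegral (connectionForm n) (fun t => truncate n g * c t) := by
    refine intervalIntegral.integral_congr fun t ht => ?_
    rw [uIcc_of_le zero_le_one] at ht
    simp only
    rw [derivWithin_congr h (h t ht), h t ht]
  rw [transport, transport, h1, lineIntegral_mul g hc.1, h 1 ⟨zero_le_one, le_rfl⟩,
    h 0 ⟨le_rfl, zero_le_one⟩, fibreCoord_mul hg, fibreCoord_mul hg, AddCircle.coe_add,
    AddCircle.coe_sub]
  abel

open Classical in
/-- The parallel transport along a path in the quotient; it is only meaningful for the paths that
have a continuously differentiable lift. -/
def holonomy (τ : unitInterval → Nilmanifold n) : HolonomyGroup n :=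
  if h : ∃ c, IsLift τ c then transport h.choose else 0

theorem holonomy_eq {τ : unitInterval → Nilmanifold n} {c : ℝ → V n} (hc : IsLift τ c) :
    holonomy τ = transport c := by
  have h : ∃ c, IsLift τ c := ⟨c, hc⟩
  rw [holonomy, dif_pos h]
  exact transport_eq_of_isLift hc h.choose_spec

/-! ### Smooth lifts of triangles -/

/-- A retraction of the plane onto the triangle. -/
def triangleRetraction (p : ℝ × ℝ) : ℝ × ℝ :=
  (max 1 (max 0 p.1 + max 0 p.2))⁻¹ • (max 0 p.1, max 0 p.2)

theorem continuous_triangleRetraction : Continuous triangleRetraction := by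
  have h1 : Continuous fun p : ℝ × ℝ => max 1 (max 0 p.1 + max 0 p.2) := by fun_prop
  have h2 : Continuous fun p : ℝ × ℝ => (max 0 p.1, max 0 p.2) := by fun_prop
  exact (h1.inv₀ fun p => (lt_max_of_lt_left zero_lt_one).ne').smul h2

theorem triangleRetraction_mem (p : ℝ × ℝ) : triangleRetraction p ∈ stdTriangle := by
  have h : 0 < max 1 (max 0 p.1 + max 0 p.2) := lt_max_of_lt_left zero_lt_one
  refine ⟨mul_nonneg (inv_nonneg.mpr h.le) (le_max_left _ _),
    mul_nonneg (inv_nonneg.mpr h.le) (le_max_left _ _), ?_⟩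
  change (_)⁻¹ * (max 0 p.1) + (_)⁻¹ * (max 0 p.2) ≤ 1
  rw [← mul_add, inv_mul_le_one₀ h]
  exact le_max_right _ _

theorem triangleRetraction_of_mem {p : ℝ × ℝ} (hp : p ∈ stdTriangle) :
    triangleRetraction p = p := by
  rw [triangleRetraction, max_eq_right hp.1, max_eq_right hp.2.1, max_eq_left hp.2.2, inv_one,
    one_smul]

/-- The triangle is simply connected, so a continuous lift through the covering exists; it is
constructed on the whole plane, after the extension of the triangle by the retraction. The lift is
smooth because the projection has smooth local inverses. -/
theorem exists_smooth_lift (σ : SmoothTriangle (V n) (Nilmanifold n)) :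
    ∃ s : ℝ × ℝ → V n, ContDiffOn ℝ ∞ s stdTriangle ∧
      ∀ p ∈ stdTriangle, proj n (s p) = σ.toFun p := by
  let f : C(ℝ × ℝ, Nilmanifold n) := ⟨fun p => σ.toFun (triangleRetraction p),
    σ.smooth.continuousOn.comp_continuous continuous_triangleRetraction triangleRetraction_mem⟩
  obtain ⟨a, ha⟩ := surjective_proj n (f 0)
  obtain ⟨s, ⟨-, hs⟩, -⟩ := (isCoveringMap_proj n).existsUnique_continuousMap_lifts f 0 a ha
  have hs' : ∀ p ∈ stdTriangle, proj n (s p) = σ.toFun p := fun p hp => by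
    rw [← Function.comp_apply (f := proj n), hs]
    exact congrArg σ.toFun (triangleRetraction_of_mem hp)
  refine ⟨s, fun p hp => ?_, hs'⟩
  have hmem : proj n (s p) ∈ (chartAt (V n) (σ.toFun p)).source := by
    rw [hs' p hp]; exact mem_chart_source (V n) _
  obtain ⟨γ, -, h⟩ := eventuallyEq_mul (chart_mem_atlas (V n) (σ.toFun p)) hmem
  have h1 : ContMDiffWithinAt 𝓘(ℝ, ℝ × ℝ) 𝓘(ℝ, V n) ∞
      (fun q => chartAt (V n) (σ.toFun p) (σ.toFun q)) stdTriangle p :=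
    (contMDiffAt_of_mem_maximalAtlas (IsManifold.chart_mem_maximalAtlas (σ.toFun p))
      (mem_chart_source (V n) (σ.toFun p))).comp_contMDiffWithinAt p (σ.smooth p hp)
  have h2 := (V.contDiff_mul_left γ⁻¹).contDiffAt.comp_contDiffWithinAt p h1.contDiffWithinAt
  have h3 : ∀ᶠ q in 𝓝[stdTriangle] p,
      s q = γ⁻¹ * chartAt (V n) (σ.toFun p) (σ.toFun q) := by
    filter_upwards [nhdsWithin_le_nhds ((s.continuous.tendsto p).eventually h),
      self_mem_nhdsWithin] with q hq hqT
    rw [← hs' q hqT, hq, inv_mul_cancel_left]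
  exact h2.congr_of_eventuallyEq_of_mem h3 hp

theorem integral_inducedForm {m : ℕ}
    (σ : SmoothTriangle (V (2 * m)) (Nilmanifold (2 * m))) {s : ℝ × ℝ → V (2 * m)}
    (hs : ContDiffOn ℝ ∞ s stdTriangle)
    (hσ : ∀ p ∈ stdTriangle, proj (2 * m) (s p) = σ.toFun p) :
    σ.integral (inducedForm m) = ∫ p in stdTriangle,
      formΩ m (s p) ![fderivWithin ℝ s stdTriangle p (1, 0),
        fderivWithin ℝ s stdTriangle p (0, 1)] := by
  refine setIntegral_congr_fun isClosed_stdTriangle.measurableSet fun p hp => ?_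
  have h1 : HasMFDerivWithinAt 𝓘(ℝ, ℝ × ℝ) 𝓘(ℝ, V (2 * m)) s stdTriangle p
      (fderivWithin ℝ s stdTriangle p) :=
    ((hs.differentiableOn (by simp) p hp).hasFDerivWithinAt).hasMFDerivWithinAt
  have h2 : HasMFDerivAt 𝓘(ℝ, V (2 * m)) 𝓘(ℝ, V (2 * m)) (proj (2 * m)) (s p)
      (mfderiv 𝓘(ℝ, V (2 * m)) 𝓘(ℝ, V (2 * m)) (proj (2 * m)) (s p)) :=
    ((contMDiff_proj (2 * m) (s p)).mdifferentiableAt (by simp)).hasMFDerivAt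
  have h3 : (mfderivWithin 𝓘(ℝ, ℝ × ℝ) 𝓘(ℝ, V (2 * m)) σ.toFun stdTriangle p :
      ℝ × ℝ →L[ℝ] V (2 * m)) =
      (mfderiv 𝓘(ℝ, V (2 * m)) 𝓘(ℝ, V (2 * m)) (proj (2 * m)) (s p) :
        V (2 * m) →L[ℝ] V (2 * m)).comp (fderivWithin ℝ s stdTriangle p) :=
    ((h2.comp_hasMFDerivWithinAt p h1).congr_of_eventuallyEq
      (Filter.eventually_of_mem self_mem_nhdsWithin fun q hq => (hσ q hq).symm)
      (hσ p hp).symm).mfderivWithin (uniqueDiffOn_stdTriangle p hp).uniqueMDiffWithinAt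
  -- `Ψ` has nondependent arguments, which permits rewriting the base point and the tangent map.
  let Ψ : Nilmanifold (2 * m) → (ℝ × ℝ →L[ℝ] V (2 * m)) → ℝ := fun q L =>
    (show V (2 * m) [⋀^Fin 2]→L[ℝ] ℝ from inducedForm m q) ![L (1, 0), L (0, 1)]
  change Ψ (σ.toFun p) (mfderivWithin 𝓘(ℝ, ℝ × ℝ) 𝓘(ℝ, V (2 * m)) σ.toFun stdTriangle p) = _
  rw [h3, ← hσ p hp]
  exact inducedForm_mfderiv_proj m (s p) _ _

/-- The integral of the form over a triangle is the holonomy around its boundary. -/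
theorem integral_eq_holonomy {m : ℕ} (σ : SmoothTriangle (V (2 * m)) (Nilmanifold (2 * m))) :
    ((σ.integral (inducedForm m) : ℝ) : HolonomyGroup (2 * m)) =
      Finsupp.linearCombination ℤ (holonomy (n := 2 * m)) σ.boundary := by
  obtain ⟨s, hs, hσ⟩ := exists_smooth_lift σ
  have hl : ∀ e : ℝ → ℝ × ℝ, ContDiff ℝ 1 e → MapsTo e (Icc 0 1) stdTriangle →
      holonomy (fun t : unitInterval => σ.toFun (e t)) = transport fun t => s (e t) :=
    fun e he hm => holonomy_eq ⟨(hs.of_le (by exact_mod_cast le_top)).comp he.contDiffOn hm,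
      fun t => hσ _ (hm t.2)⟩
  have h1 := hl (fun t => (1 - t, t)) (by fun_prop)
    fun t ht => ⟨by linarith [ht.2], ht.1, by simp⟩
  have h2 := hl (fun t => (0, t)) (by fun_prop) fun t ht => ⟨le_rfl, ht.1, by simpa using ht.2⟩
  have h3 := hl (fun t => (t, 0)) (by fun_prop) fun t ht => ⟨ht.1, le_rfl, by simpa using ht.2⟩
  rw [SmoothTriangle.boundary, map_add, map_sub, Finsupp.linearCombination_single,
    Finsupp.linearCombination_single, Finsupp.linearCombination_single, one_smul, one_smul,
    one_smul, h1, h2, h3, integral_inducedForm σ hs hσ]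
  simp only [formΩ_eq_fderiv]
  rw [setIntegral_stdTriangle_eq_lineIntegral contDiff_connectionForm hs]
  simp only [transport, AddCircle.coe_add, AddCircle.coe_sub, sub_self, sub_zero]
  abel

theorem integral_smul {E M : Type*} [NormedAddCommGroup E] [NormedSpace ℝ E] [TopologicalSpace M]
    [ChartedSpace E M] (σ : SmoothTriangle E M) (r : ℝ) (η : TwoForm E M) :
    σ.integral (r • η) = r * σ.integral η :=
  integral_const_mul r _

theorem isIntegralForm_inducedForm (m : ℕ) :
    IsIntegralForm ((denominator (2 * m) : ℝ) • inducedForm m) := by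
  intro c hc
  have hN : (denominator (2 * m) : ℝ) ≠ 0 := by exact_mod_cast (denominator_pos (2 * m)).ne'
  have h : ((c.sum fun σ a => (a : ℝ) * σ.integral (inducedForm m) : ℝ) :
      HolonomyGroup (2 * m)) = 0 := by
    have h1 := congrArg (Finsupp.linearCombination ℤ (holonomy (n := 2 * m))) hc
    rw [map_zero, map_finsuppSum] at h1
    rw [← h1, Finsupp.sum, Finsupp.sum]
    rw [← QuotientAddGroup.mk'_apply, map_sum]
    refine Finset.sum_congr rfl fun σ _ => ?_
    rw [← zsmul_eq_mul, map_zsmul, map_zsmul, QuotientAddGroup.mk'_apply, ← integral_eq_holonomy]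
  obtain ⟨k, hk⟩ := (AddCircle.coe_eq_zero_iff _).mp h
  refine ⟨k, ?_⟩
  simp only [integral_smul, mul_left_comm _ (denominator (2 * m) : ℝ)]
  rw [← Finsupp.mul_sum, ← hk, zsmul_eq_mul, mul_left_comm, mul_inv_cancel₀ hN, mul_one]

end Nilmanifold

end

open scoped Manifold ContDiff in
theorem corollary1 (m : ℕ) (hm : 2 ≤ m) :
    DiscreteTopology (latticeΓ (2 * m)) ∧
    CompactSpace (Nilmanifold (2 * m)) ∧
    T2Space (Nilmanifold (2 * m)) ∧
    ∃ (_ : ChartedSpace (V (2 * m)) (Nilmanifold (2 * m)))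
      (_ : IsManifold 𝓘(ℝ, V (2 * m)) ∞ (Nilmanifold (2 * m))),
      IsLocalDiffeomorph 𝓘(ℝ, V (2 * m)) 𝓘(ℝ, V (2 * m)) ∞ (Nilmanifold.proj (2 * m)) ∧
      ∃ η : TwoForm (V (2 * m)) (Nilmanifold (2 * m)),
        pullbackForm (Nilmanifold.proj (2 * m)) η = formΩ m ∧
        IsSymplecticForm η ∧
        ∃ N : ℕ, 0 < N ∧
          IsSymplecticForm ((N : ℝ) • η) ∧ IsIntegralForm ((N : ℝ) • η) := by
  have hN := V.denominator_pos (2 * m)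
  have hsymp := Nilmanifold.isSymplecticForm_inducedForm m
  exact ⟨discreteTopology_latticeΓ _, Nilmanifold.compactSpace _, Nilmanifold.t2Space _,
    Nilmanifold.chartedSpace _, Nilmanifold.isManifold _, Nilmanifold.isLocalDiffeomorph_proj _,
    Nilmanifold.inducedForm m, Nilmanifold.pullbackForm_proj m, hsymp,
    V.denominator (2 * m), hN, hsymp.smul (by exact_mod_cast hN.ne'),
    Nilmanifold.isIntegralForm_inducedForm m⟩
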